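/- Let $G$ be a finite simple graph with $n$ vertices, $q$ edges and $r$ connected components, and let $k$ be a field. An orientation $\mathcal O$ of $G$ directs each edge $e$ from one of its ends, its tail $x_{t(e)}$, to its other end, its head $x_{h(e)}$. The toric ideal $P_{G_{\mathcal O}}$ is the kernel of the homomorphism of $k$-algebras \[ k[t_e \mid e\in E(G)] \longrightarrow k[x_1^{\pm1},\dots,x_n^{\pm1}],\qquad t_e\longmapsto x_{h(e)}\,x_{t(e)}^{-1}. \] The graph $G$ is called a $\mathrm{CI}\mathcal O$ graph if for every orientation $\mathcal O$ of $G$ the ideal $P_{G_{\mathcal O}}$ is a binomial complete intersection, that is, it is generated by exactly $q-n+r$ binomials $t^\alpha-t^\beta$. A block of $G$ is a maximal connected subgraph without a cut vertex of its own. A subgraph $H$ is the $2$-clique-sum of the subgraphs $H_1$ and $H_2$ if $H=H_1\cup H_2$ and $H_1\cap H_2$ consists of a single edge and its two ends. The graph $G$ is called a ring graph if each block of $G$ which is not a bridge or a vertex can be constructed successively by $2$-clique-sums of cycles, that is, from a cycle by repeatedly (possibly zero times) forming the $2$-clique-sum with one more cycle. Corollary. If $G$ is a ring graph, then $G$ is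 a $\mathrm{CI}\mathcal O$ graph. Conversely, if $G$ is bipartite and $G$ is a $\mathrm{CI}\mathcal O$ graph, then $G$ is a ring graph. -/

import Mathlib

/-- An orientation of a simple graph `G`: each edge `e` gets a direction, from its end `tail e` to its
other end `head e`. -/
structure GraphOrientation {V : Type*} (G : SimpleGraph V) where
  tail : G.edgeSet → V
  head : G.edgeSet → V
  mk_eq : ∀ e : G.edgeSet, s(tail e, head e) = (e : Sym2 V)

namespace GraphOrientation

variable {V : Type*} {G : SimpleGraph V}

/-- The column of the incidence matrix attached to the oriented edge `e`: the entry at the tail is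
`-1`, the entry at the head is `1` and all other entries are `0`. -/
noncomputable def incidenceVector (O : GraphOrientation G) (e : G.edgeSet) : V →₀ ℤ :=
  Finsupp.single (O.head e) 1 - Finsupp.single (O.tail e) 1

/-- The homomorphism of `k`-algebras from the polynomial ring with one variable `t_e` for each edge `e`
to the ring of Laurent polynomials with one variable for each vertex (the group algebra of `V →₀ ℤ`),
which sends `t_e` to the Laurent monomial `x_head / x_tail`. -/
noncomputable def toricMap (k : Type*) [Field k] (O : GraphOrientation G) :
    MvPolynomial G.edgeSet k →ₐ[k] AddMonoidAlgebra k (V →₀ ℤ) :=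
  MvPolynomial.aeval fun e => AddMonoidAlgebra.single (O.incidenceVector e) (1 : k)

/-- The toric ideal of the oriented graph. -/
noncomputable def toricIdeal (k : Type*) [Field k] (O : GraphOrientation G) :
    Ideal (MvPolynomial G.edgeSet k) :=
  RingHom.ker (toricMap k O)

end GraphOrientation

/-- A binomial: a difference `t^α - t^β` of two distinct monomials. -/
def IsPureBinomial {σ k : Type*} [Field k] (f : MvPolynomial σ k) : Prop :=
  ∃ α β : σ →₀ ℕ, α ≠ β ∧ f = MvPolynomial.monomial α 1 - MvPolynomial.monomial β 1

namespace SimpleGraph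

/-- The toric ideal of the oriented graph is generated by exactly `q - n + r` binomials, where `q`, `n`
and `r` are the numbers of edges, vertices and connected components. -/
def IsBinomialCompleteIntersection {V : Type*} {G : SimpleGraph V} (k : Type*) [Field k]
    (O : GraphOrientation G) : Prop :=
  ∃ S : Finset (MvPolynomial G.edgeSet k),
    (S.card : ℤ) = Nat.card G.edgeSet - Nat.card V + Nat.card G.ConnectedComponent ∧
    (∀ f ∈ S, IsPureBinomial f) ∧
    Ideal.span (S : Set (MvPolynomial G.edgeSet k)) = O.toricIdeal k

/-- For every orientation of `G` the toric ideal over `k` is a binomial complete intersection. -/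
def IsCIOGraph {V : Type*} (k : Type*) [Field k] (G : SimpleGraph V) : Prop :=
  ∀ O : GraphOrientation G, IsBinomialCompleteIntersection k O

namespace Subgraph

variable {V : Type*} {G : SimpleGraph V}

/-- A connected subgraph without a cut vertex of its own. -/
def IsNonseparable (H : G.Subgraph) : Prop :=
  H.Connected ∧ ∀ v ∈ H.verts, (H.deleteVerts {v}).Preconnected

/-- A block of `G`: a maximal connected subgraph without a cut vertex. -/
def IsGraphBlock (B : G.Subgraph) : Prop :=
  Maximal (fun H : G.Subgraph => H.IsNonseparable) B

/-- The subgraph is a single vertex. -/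
def IsVertex (B : G.Subgraph) : Prop :=
  ∃ v : V, B = G.singletonSubgraph v

/-- The subgraph is a single edge, with its two ends, and this edge is a bridge of `G`. -/
def IsBridgeEdge (B : G.Subgraph) : Prop :=
  ∃ (u v : V) (h : G.Adj u v), G.IsBridge s(u, v) ∧ B = G.subgraphOfAdj h

/-- The subgraph is a cycle (of length at least three). -/
def IsCycleSubgraph (C : G.Subgraph) : Prop :=
  ∃ (u : V) (w : G.Walk u u), w.IsCycle ∧ C = w.toSubgraph

/-- `H` is the `m`-clique-sum of `H₁` and `H₂`: it is their union, and what they have in common is a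
complete graph on `m` vertices. -/
def IsCliqueSum (m : ℕ) (H₁ H₂ H : G.Subgraph) : Prop :=
  H = H₁ ⊔ H₂ ∧ (H₁ ⊓ H₂).verts.encard = m ∧ (H₁ ⊓ H₂).coe = ⊤

/-- The subgraphs that are constructed successively by `2`-clique-sums of cycles: start with a cycle,
and form the `2`-clique-sum (along an edge) with one more cycle, any finite number of times. -/
inductive IsTwoSumOfCycles : G.Subgraph → Prop
  | cycle (C : G.Subgraph) : C.IsCycleSubgraph → IsTwoSumOfCycles C
  | sum (H C H' : G.Subgraph) : IsTwoSumOfCycles H → C.IsCycleSubgraph → IsCliqueSum 2 H C H' →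
      IsTwoSumOfCycles H'

end Subgraph

/-- Each block that is neither a vertex nor a bridge can be constructed successively by `2`-clique-sums
of cycles. -/
def IsRingGraph {V : Type*} (G : SimpleGraph V) : Prop :=
  ∀ B : G.Subgraph, B.IsGraphBlock → ¬ B.IsVertex → ¬ B.IsBridgeEdge → B.IsTwoSumOfCycles

end SimpleGraph

/-! A binomial `t^α - t^β` lies in the toric ideal exactly when `α - β` is an integer flow, and the
flows over a field form a space of dimension `q - n + r`. Any binomials that generate the toric
ideal have exponent differences that span the flows modulo `2` (`span_modTwo_eq_flows`). Working
modulo `2` makes signs and orientations disappear.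

Ring graphs. On a cycle all flows are multiples of one vector, so one binomial suffices
(`generatesOn_isCycle`). If two parts share only an edge and its ends, a flow on the union splits
into two flows once a suitable multiple of the common edge is moved from one part to the other, so
the generators of the parts suffice (`GeneratesOn.union_of_inter_edge`). Flows restrict to blocks,
hence the blocks can be treated separately. The vectors obtained are independent modulo `2`, which
gives the right number of generators.

Converse. Orient the bipartite graph from one side to the other. At each vertex all signs agree, so
no cancellation occurs, and the two monomials of a chordless cycle are the only ones with their
image (`eq_or_eq_of_expBoundary_eq`). Its binomial therefore occurs, up to sign, in each generating
set of binomials. As `q - n + r` generators give a basis modulo `2`, the chordless cycles are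
linearly independent (`linearIndepOn_chordlessVectors`).

Now let `H` be a maximal subgraph of a block among the `2`-sums of cycles that contain a given edge,
are induced, and have their flows spanned by their chordless cycles. If `H` misses a vertex of the
block, take a shortest ear of `H`. Were no two of its attaching vertices adjacent, there would be so
many chordless cycles through the ear that some combination of them has support in `H`, against
independence (`exists_adj_of_isMinimalEar`). So two attaching vertices are adjacent. There is no
triangle, hence the ear has more than one vertex and closes up to a cycle glued to `H` along an edge
(`IsCycleGenerated.sup_ear`), against maximality. -/

/-! ### Binomials in an ideal generated by binomials -/

section Binomials

open MvPolynomial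

variable {σ k : Type*} [Field k]

/-- The binomial `t^α - t^β`. -/
noncomputable def pureBinomial (k : Type*) [Field k] (α β : σ →₀ ℕ) : MvPolynomial σ k :=
  monomial α 1 - monomial β 1

/-- The difference of two exponents, as an integer vector. -/
def expDiff (α β : σ →₀ ℕ) : σ → ℤ := fun e => (α e : ℤ) - β e

lemma expDiff_eq_zero {α β : σ →₀ ℕ} : expDiff α β = 0 ↔ α = β := by
  constructor
  · intro h
    ext e
    have := congrFun h e
    simp only [expDiff, Pi.zero_apply] at this
    omega
  · rintro rfl
    ext e
    simp [expDiff]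

/-- If `t^α - t^β` lies in the ideal generated by binomials whose exponent differences lie in a
lattice `L`, then the difference of `α` and `β` lies in `L`. -/
lemma expDiff_mem_of_mem_span {S : Set (MvPolynomial σ k)} {L : AddSubgroup (σ → ℤ)}
    (hS : ∀ f ∈ S, ∃ a b, f = pureBinomial k a b ∧ expDiff a b ∈ L) {α β : σ →₀ ℕ}
    (h : pureBinomial k α β ∈ Ideal.span S) : expDiff α β ∈ L := by
  classical
  -- Grade the polynomials by the quotient group modulo `L`. The map `φ` remembers only the class of
  -- a monomial, so it kills the generators, and it kills a binomial only if both exponents have the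
  -- same class.
  let cl : (σ →₀ ℕ) →+ (σ → ℤ) ⧸ L := (QuotientAddGroup.mk' L).comp
    { toFun := fun a e => (a e : ℤ)
      map_zero' := by ext; simp
      map_add' := by intros; ext; simp }
  have hcl : ∀ a b, cl a = cl b ↔ expDiff a b ∈ L := by
    intro a b
    have h1 : cl a = cl b ↔ cl a - cl b = 0 := sub_eq_zero.symm
    rw [h1]
    simp only [cl, AddMonoidHom.comp_apply, ← map_sub]
    exact QuotientAddGroup.eq_zero_iff _
  let φ : MvPolynomial σ k →ₐ[k] AddMonoidAlgebra k ((σ → ℤ) ⧸ L) :=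
    AddMonoidAlgebra.mapDomainAlgHom k k cl
  have hφ : ∀ a, φ (monomial a 1) = AddMonoidAlgebra.single (cl a) 1 := by
    intro a
    exact AddMonoidAlgebra.mapDomain_single
  have hle : Ideal.span S ≤ RingHom.ker φ := by
    rw [Ideal.span_le]
    intro f hf
    obtain ⟨a, b, rfl, hab⟩ := hS f hf
    rw [SetLike.mem_coe, RingHom.mem_ker, pureBinomial, map_sub, hφ, hφ, (hcl a b).2 hab, sub_self]
  have := hle h
  rw [RingHom.mem_ker, pureBinomial, map_sub, hφ, hφ, sub_eq_zero] at this
  rw [← hcl]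
  by_contra hne
  have h2 := congrArg (fun f => f.coeff (cl α)) this
  simp [AddMonoidAlgebra.coeff_single, Ne.symm hne] at h2

/-- A binomial `t^α - t^β` in the ideal generated by some binomials can be rewritten at `t^α` by one
of them. -/
lemma exists_rewrite_of_mem_span {S : Set (MvPolynomial σ k)}
    (hS : ∀ f ∈ S, IsPureBinomial f) {α β : σ →₀ ℕ} (hne : α ≠ β)
    (h : pureBinomial k α β ∈ Ideal.span S) :
    ∃ a b : σ →₀ ℕ, a ≠ b ∧ a ≤ α ∧ (pureBinomial k a b ∈ S ∨ pureBinomial k b a ∈ S) := by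
  classical
  by_contra hcon
  push Not at hcon
  -- The polynomials without any monomial dividing `t^α` form an ideal. If no generator applies to
  -- `t^α`, this ideal contains `S`, although `t^α` itself occurs in the given binomial.
  let I : Ideal (MvPolynomial σ k) :=
    { carrier := {f | ∀ γ ≤ α, coeff γ f = 0}
      zero_mem' := by simp
      add_mem' := by
        intro f g hf hg γ hγ
        rw [coeff_add, hf γ hγ, hg γ hγ, add_zero]
      smul_mem' := by
        intro c f hf γ hγ
        rw [smul_eq_mul, coeff_mul]
        refine Finset.sum_eq_zero fun x hx => ?_
        rw [Finset.HasAntidiagonal.mem_antidiagonal] at hx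
        rw [hf x.2 (le_trans (hx ▸ le_add_self) hγ), mul_zero] }
  have hle : Ideal.span S ≤ I := by
    rw [Ideal.span_le]
    intro f hf γ hγ
    obtain ⟨a, b, hab, rfl⟩ := hS f hf
    rw [coeff_sub, coeff_monomial, coeff_monomial, if_neg, if_neg, sub_zero]
    · rintro rfl
      exact (hcon b a hab.symm hγ).2 hf
    · rintro rfl
      exact (hcon a b hab hγ).1 hf
  have := hle h α le_rfl
  simp [pureBinomial, coeff_sub, coeff_monomial, hne.symm] at this

end Binomials

/-! ### The toric ideal in terms of boundaries and flows -/

namespace GraphOrientation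

open MvPolynomial

variable {V : Type*} {G : SimpleGraph V} (O : GraphOrientation G)

lemma head_mem (e : G.edgeSet) : O.head e ∈ (e : Sym2 V) := by
  rw [← O.mk_eq e]; simp

lemma tail_mem (e : G.edgeSet) : O.tail e ∈ (e : Sym2 V) := by
  rw [← O.mk_eq e]; simp

lemma tail_ne_head (e : G.edgeSet) : O.tail e ≠ O.head e := by
  have h := e.2
  rw [← O.mk_eq e, SimpleGraph.mem_edgeSet] at h
  exact h.ne

lemma mem_edge_iff (e : G.edgeSet) (v : V) : v ∈ (e : Sym2 V) ↔ v = O.tail e ∨ v = O.head e := by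
  rw [← O.mk_eq e, Sym2.mem_iff]

lemma incidenceVector_apply [DecidableEq V] (e : G.edgeSet) (v : V) : O.incidenceVector e v =
    (if O.head e = v then 1 else 0) - (if O.tail e = v then 1 else 0) := by
  simp [incidenceVector, Finsupp.single_apply]

lemma incidenceVector_of_notMem {e : G.edgeSet} {v : V} (h : v ∉ (e : Sym2 V)) :
    O.incidenceVector e v = 0 := by
  classical
  rw [mem_edge_iff O] at h
  push Not at h
  rw [incidenceVector_apply, if_neg h.2.symm, if_neg h.1.symm, sub_zero]

/-- Invertibility lets the flow condition at a vertex be solved for one edge over any coefficient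
ring. -/
lemma incidenceVector_isUnit {e : G.edgeSet} {v : V} (h : v ∈ (e : Sym2 V)) :
    IsUnit (O.incidenceVector e v) := by
  classical
  rw [incidenceVector_apply]
  have hne := O.tail_ne_head e
  rcases (O.mem_edge_iff e v).1 h with rfl | rfl
  · rw [if_neg hne.symm, if_pos rfl]; decide
  · rw [if_neg hne, if_pos rfl]; decide

/-- The boundary of the monomial with exponent `α`: the exponent of its image under the toric map. -/
noncomputable def expBoundary : (G.edgeSet →₀ ℕ) →+ (V →₀ ℤ) :=
  Finsupp.liftAddHom fun e => multiplesHom (V →₀ ℤ) (O.incidenceVector e)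

lemma toricMap_monomial (k : Type*) [Field k] (α : G.edgeSet →₀ ℕ) (c : k) :
    O.toricMap k (monomial α c) = AddMonoidAlgebra.single (O.expBoundary α) c := by
  classical
  rw [toricMap, aeval_monomial, expBoundary, Finsupp.liftAddHom_apply]
  have : ∀ s : Finset G.edgeSet,
      (∏ e ∈ s, AddMonoidAlgebra.single (O.incidenceVector e) (1 : k) ^ α e) =
        AddMonoidAlgebra.single (∑ e ∈ s, multiplesHom (V →₀ ℤ) (O.incidenceVector e) (α e)) 1 := by
    intro s
    induction s using Finset.induction_on with
    | empty => simp [AddMonoidAlgebra.one_def]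
    | insert a s ha ih =>
      rw [Finset.prod_insert ha, Finset.sum_insert ha, ih, AddMonoidAlgebra.single_pow,
        AddMonoidAlgebra.single_mul_single]
      simp
  rw [Finsupp.prod, this, Finsupp.sum]
  simp [AddMonoidAlgebra.single_mul_single]

lemma pureBinomial_mem_toricIdeal {k : Type*} [Field k] {α β : G.edgeSet →₀ ℕ} :
    pureBinomial k α β ∈ O.toricIdeal k ↔ O.expBoundary α = O.expBoundary β := by
  classical
  rw [toricIdeal, RingHom.mem_ker, pureBinomial, map_sub, toricMap_monomial, toricMap_monomial,
    sub_eq_zero]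
  constructor
  · intro h
    by_contra hne
    have h2 := congrArg (fun f => f.coeff (O.expBoundary α)) h
    simp [AddMonoidAlgebra.coeff_single, Ne.symm hne] at h2
  · intro h
    rw [h]

/-- The toric ideal is contained in each ideal that contains the binomials `t^α - t^β` for which `α`
and `β` have the same boundary. -/
lemma toricIdeal_le {k : Type*} [Field k] {I : Ideal (MvPolynomial G.edgeSet k)}
    (hI : ∀ α β, O.expBoundary α = O.expBoundary β → pureBinomial k α β ∈ I) :
    O.toricIdeal k ≤ I := by
  classical
  intro f hf
  rw [toricIdeal, RingHom.mem_ker] at hf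
  -- Pick one exponent for each boundary. Applying the toric map and then `Ψ` replaces each monomial
  -- by the chosen one, which changes nothing modulo `I`. An element of the kernel becomes zero.
  let rep : (V →₀ ℤ) → (G.edgeSet →₀ ℕ) := Function.invFun O.expBoundary
  have hrep : ∀ α, O.expBoundary (rep (O.expBoundary α)) = O.expBoundary α := fun α =>
    Function.invFun_eq ⟨α, rfl⟩
  let Ψ : ((V →₀ ℤ) →₀ k) →+ MvPolynomial G.edgeSet k :=
    Finsupp.liftAddHom fun d => (monomial (R := k) (rep d)).toAddMonoidHom
  have key : ∀ g : MvPolynomial G.edgeSet k, g - Ψ (O.toricMap k g).coeff ∈ I := by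
    intro g
    induction g using MvPolynomial.induction_on' with
    | monomial u a =>
      rw [toricMap_monomial, AddMonoidAlgebra.coeff_single]
      have : Ψ (Finsupp.single (O.expBoundary u) a) = monomial (rep (O.expBoundary u)) a := by
        simp [Ψ]
      rw [this]
      have h := I.mul_mem_left (C a) (hI u (rep (O.expBoundary u)) (hrep u).symm)
      rwa [pureBinomial, mul_sub, C_mul_monomial, C_mul_monomial, mul_one] at h
    | add p q hp hq =>
      have := I.add_mem hp hq
      rw [map_add, AddMonoidAlgebra.coeff_add, map_add]
      convert this using 1
      ring
  have := key f
  rwa [hf, AddMonoidAlgebra.coeff_zero, map_zero, sub_zero] at this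

section Boundary

variable [Fintype G.edgeSet] {R : Type*} [CommRing R]

/-- The boundary map of the oriented graph with coefficients in `R`. Its kernel consists of the flows. -/
noncomputable def boundary (R : Type*) [CommRing R] : (G.edgeSet → R) →ₗ[R] (V → R) where
  toFun z v := ∑ e, z e * (O.incidenceVector e v : R)
  map_add' x y := by ext v; simp [add_mul, Finset.sum_add_distrib]
  map_smul' c x := by ext v; simp [mul_assoc, Finset.mul_sum]

lemma boundary_apply (z : G.edgeSet → R) (v : V) :
    O.boundary R z v = ∑ e, z e * (O.incidenceVector e v : R) := rfl

/-- The module of flows. -/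
noncomputable def flows (R : Type*) [CommRing R] : Submodule R (G.edgeSet → R) :=
  LinearMap.ker (O.boundary R)

lemma mem_flows {z : G.edgeSet → R} : z ∈ O.flows R ↔ ∀ v, O.boundary R z v = 0 := by
  rw [flows, LinearMap.mem_ker, funext_iff]
  rfl

lemma expBoundary_apply (α : G.edgeSet →₀ ℕ) (v : V) :
    O.expBoundary α v = O.boundary ℤ (fun e => (α e : ℤ)) v := by
  rw [expBoundary, Finsupp.liftAddHom_apply, Finsupp.sum_fintype _ _ (by simp), boundary_apply,
    Finsupp.finsetSum_apply]
  simp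

lemma expBoundary_eq_iff {α β : G.edgeSet →₀ ℕ} :
    O.expBoundary α = O.expBoundary β ↔ expDiff α β ∈ O.flows ℤ := by
  rw [mem_flows, DFunLike.ext_iff]
  refine forall_congr' fun v => ?_
  rw [expBoundary_apply, expBoundary_apply, ← sub_eq_zero, ← Pi.sub_apply, ← map_sub]
  rfl

lemma boundary_cast {z : G.edgeSet → ℤ} (v : V) :
    O.boundary R (fun e => (z e : R)) v = (O.boundary ℤ z v : ℤ) := by
  simp [boundary_apply]

lemma cast_mem_flows {z : G.edgeSet → ℤ} (hz : z ∈ O.flows ℤ) :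
    (fun e => (z e : R)) ∈ O.flows R := by
  rw [mem_flows] at hz ⊢
  intro v
  rw [boundary_cast, hz, Int.cast_zero]

end Boundary

end GraphOrientation

/-! ### Walks, cycles and the space of flows -/

/-- The indicator vector modulo `2` of the edges of a walk. -/
noncomputable def SimpleGraph.Walk.edgeIndicator {V : Type*} {G : SimpleGraph V} {u v : V}
    (p : G.Walk u v) : G.edgeSet → ZMod 2 :=
  open Classical in fun e => if (e : Sym2 V) ∈ p.edges then 1 else 0

namespace GraphOrientation

open SimpleGraph

variable {V : Type*} {G : SimpleGraph V} (O : GraphOrientation G)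

open Classical in
/-- The signed vector of a walk: each step along an edge contributes `1` or `-1`, depending on whether
it agrees with the orientation. -/
noncomputable def walkVec : ∀ {u v : V}, G.Walk u v → G.edgeSet → ℤ
  | _, _, .nil => 0
  | u, _, .cons (v := w) h p =>
      Pi.single ⟨s(u, w), h⟩ (O.incidenceVector ⟨s(u, w), h⟩ w) + walkVec p

lemma walkVec_of_notMem {u v : V} (p : G.Walk u v) {e : G.edgeSet} (he : (e : Sym2 V) ∉ p.edges) :
    O.walkVec p e = 0 := by
  classical
  induction p with
  | nil => rfl
  | cons h p ih =>
    rw [Walk.edges_cons, List.mem_cons, not_or] at he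
    rw [walkVec, Pi.add_apply, ih he.2, Pi.single_eq_of_ne (fun h => he.1 (congrArg _ h)), add_zero]

lemma walkVec_isUnit {u v : V} (p : G.Walk u v) (hp : p.IsTrail) {e : G.edgeSet}
    (he : (e : Sym2 V) ∈ p.edges) : IsUnit (O.walkVec p e) := by
  classical
  induction p with
  | nil => simp at he
  | @cons u w v h p ih =>
    rw [Walk.isTrail_cons] at hp
    rw [Walk.edges_cons, List.mem_cons] at he
    rw [walkVec, Pi.add_apply]
    by_cases hc : (e : Sym2 V) = s(u, w)
    · have : e = ⟨s(u, w), h⟩ := Subtype.ext hc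
      subst this
      rw [Pi.single_eq_same, walkVec_of_notMem O p hp.2, add_zero]
      exact O.incidenceVector_isUnit (by simp)
    · rw [Pi.single_eq_of_ne (fun h => hc (congrArg _ h)), zero_add]
      exact ih hp.1 (he.resolve_left hc)

lemma walkVec_cast_eq_edgeIndicator {u v : V} (p : G.Walk u v) (hp : p.IsTrail) :
    (fun e => (O.walkVec p e : ZMod 2)) = p.edgeIndicator := by
  classical
  ext e
  rw [Walk.edgeIndicator]
  split_ifs with h
  · rcases Int.isUnit_iff.1 (O.walkVec_isUnit p hp h) with h | h <;> rw [h] <;> decide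
  · rw [O.walkVec_of_notMem p h, Int.cast_zero]

variable [Fintype G.edgeSet] {R : Type*} [CommRing R]

-- The contributions at inner vertices cancel, however the edges are oriented; this makes closed
-- walks into flows.
open Classical in
lemma boundary_walkVec {u v : V} (p : G.Walk u v) (x : V) :
    O.boundary ℤ (O.walkVec p) x = (if x = v then 1 else 0) - (if x = u then 1 else 0) := by
  induction p with
  | nil => simp [walkVec]
  | @cons u w v h p ih =>
    rw [walkVec, map_add, Pi.add_apply, ih, boundary_apply]
    set e : G.edgeSet := ⟨s(u, w), h⟩ with he
    rw [Finset.sum_eq_single e (fun b _ hb => by rw [Pi.single_eq_of_ne hb, zero_mul])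
      (fun h => absurd (Finset.mem_univ _) h), Pi.single_eq_same]
    have hne : u ≠ w := h.ne
    have hmk : s(O.tail e, O.head e) = s(u, w) := O.mk_eq e
    rw [Sym2.eq_iff] at hmk
    simp only [incidenceVector_apply]
    rcases hmk with ⟨h1, h2⟩ | ⟨h1, h2⟩
    · rw [h1, h2, if_pos rfl, if_neg hne]
      simp only [eq_comm (a := x), Int.cast_sub, Int.cast_ite, Int.cast_zero, Int.cast_one]
      ring
    · rw [h1, h2, if_pos rfl, if_neg hne]
      simp only [eq_comm (a := x), Int.cast_sub, Int.cast_ite, Int.cast_zero, Int.cast_one]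
      ring

lemma walkVec_mem_flows {u : V} (p : G.Walk u u) : O.walkVec p ∈ O.flows ℤ := by
  classical
  rw [mem_flows]
  intro v
  rw [boundary_walkVec, sub_self]

lemma edgeIndicator_mem_flows {u : V} (p : G.Walk u u) (hp : p.IsTrail) :
    p.edgeIndicator ∈ O.flows (ZMod 2) := by
  rw [← O.walkVec_cast_eq_edgeIndicator p hp]
  exact O.cast_mem_flows (O.walkVec_mem_flows p)

/-- A vector that satisfies the flow condition at the vertices of a path except its last one, and
that vanishes on the other edges at these vertices, vanishes on the path. -/
lemma eq_zero_of_isPath {z : G.edgeSet → R} {u v : V} (p : G.Walk u v) (hp : p.IsPath)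
    (hz : ∀ w ∈ p.support, w ≠ v → O.boundary R z w = 0)
    (hs : ∀ e, z e ≠ 0 → (e : Sym2 V) ∈ p.edges ∨ ∀ w ∈ p.support, w ≠ v → w ∉ (e : Sym2 V)) :
    ∀ e : G.edgeSet, (e : Sym2 V) ∈ p.edges → z e = 0 := by
  induction p with
  | nil => simp
  | @cons u a v h p ih =>
    rw [Walk.cons_isPath_iff] at hp
    have huv : u ≠ v := fun h => hp.2 (h ▸ p.end_mem_support)
    set e₀ : G.edgeSet := ⟨s(u, a), h⟩ with he₀
    -- At its first vertex the path edge `e₀` is the only edge that can carry flow, so it carries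
    -- none. The remaining path then satisfies the same hypotheses.
    have h0 : z e₀ = 0 := by
      have hb := hz u (by simp) huv
      rw [boundary_apply, Finset.sum_eq_single e₀ ?_ (fun h => absurd (Finset.mem_univ _) h)] at hb
      · have hu : IsUnit ((O.incidenceVector e₀ u : ℤ) : R) :=
          (O.incidenceVector_isUnit (e := e₀) (v := u) (by simp [he₀])).map (Int.castRingHom R)
        exact (hu.mul_left_eq_zero).1 hb
      · intro e _ hne
        by_cases hze : z e = 0
        · rw [hze, zero_mul]
        · rw [O.incidenceVector_of_notMem, Int.cast_zero, mul_zero]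
          intro hue
          rcases hs e hze with h1 | h1
          · rw [Walk.edges_cons, List.mem_cons] at h1
            rcases h1 with h1 | h1
            · exact hne (Subtype.ext h1)
            · exact hp.2 (p.mem_support_of_mem_edges h1 hue)
          · exact h1 u (by simp) huv hue
    intro e he
    rw [Walk.edges_cons, List.mem_cons] at he
    rcases he with he | he
    · rw [show e = e₀ from Subtype.ext he, h0]
    · refine ih hp.1 (fun w hw => hz w (by simp [hw])) (fun e' he' => ?_) e he
      rcases hs e' he' with h1 | h1
      · rw [Walk.edges_cons, List.mem_cons] at h1
        exact Or.inl (h1.resolve_left fun h2 => he' ((show e' = e₀ from Subtype.ext h2) ▸ h0))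
      · exact Or.inr fun w hw => h1 w (by simp [hw])

/-- Each edge on which a flow does not vanish lies on a cycle on which it does not vanish. -/
lemma exists_isCycle_of_flow [Finite V] {z : G.edgeSet → R} (hz : z ∈ O.flows R) {e : G.edgeSet}
    (he : z e ≠ 0) : ∃ (u : V) (w : G.Walk u u), w.IsCycle ∧ (e : Sym2 V) ∈ w.edges ∧
      ∀ e' : G.edgeSet, (e' : Sym2 V) ∈ w.edges → z e' ≠ 0 := by
  classical
  cases nonempty_fintype V
  let Gz : SimpleGraph V := SimpleGraph.fromEdgeSet {x | ∃ h : x ∈ G.edgeSet, z ⟨x, h⟩ ≠ 0}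
  have hadj : ∀ e' : G.edgeSet, z e' ≠ 0 → Gz.Adj (O.tail e') (O.head e') := by
    intro e' he'
    rw [SimpleGraph.fromEdgeSet_adj]
    refine ⟨?_, O.tail_ne_head e'⟩
    rw [O.mk_eq e']
    exact ⟨e'.2, he'⟩
  have hmem : ∀ x : Sym2 V, x ∈ Gz.edgeSet → ∃ h : x ∈ G.edgeSet, z ⟨x, h⟩ ≠ 0 := by
    intro x hx
    rw [SimpleGraph.edgeSet_fromEdgeSet] at hx
    exact hx.1
  have hle : Gz ≤ G := by
    intro a b hab
    exact (hmem s(a, b) hab).1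
  -- No flow crosses a bridge of the support: summing the boundary over the side `T` of the tail
  -- leaves only `-z e`, since every other edge of the support has both ends or neither in `T`.
  have hnb : ¬ Gz.IsBridge s(O.tail e, O.head e) := by
    rw [SimpleGraph.isBridge_iff]
    intro hnr
    let T : Finset V :=
      {v | (Gz.deleteEdges {s(O.tail e, O.head e)}).Reachable (O.tail e) v}
    have hsum : ∑ v ∈ T, O.boundary R z v = 0 :=
      Finset.sum_eq_zero fun v _ => O.mem_flows.1 hz v
    simp only [boundary_apply] at hsum
    rw [Finset.sum_comm, Finset.sum_eq_single e ?_ (fun h => absurd (Finset.mem_univ _) h)] at hsum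
    · have h1 : ∑ v ∈ T, z e * ((O.incidenceVector e v : ℤ) : R) = - z e := by
        rw [Finset.sum_eq_single (O.tail e)]
        · rw [incidenceVector_apply, if_neg (O.tail_ne_head e).symm, if_pos rfl]
          simp
        · intro b hb hne
          rw [incidenceVector_apply, if_neg (Ne.symm hne), if_neg]
          · simp
          · rintro rfl
            exact hnr (by simpa [T] using hb)
        · intro h
          exact absurd (by simp [T]) h
      rw [h1, neg_eq_zero] at hsum
      exact he hsum
    · intro e' _ hne
      by_cases hze : z e' = 0
      · simp [hze]
      · have h2 : O.tail e' ∈ T ↔ O.head e' ∈ T := by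
          have h3 : (Gz.deleteEdges {s(O.tail e, O.head e)}).Adj (O.tail e') (O.head e') := by
            rw [SimpleGraph.deleteEdges_adj]
            refine ⟨hadj e' hze, ?_⟩
            rw [O.mk_eq, O.mk_eq]
            exact fun h => hne (Subtype.ext h)
          simp only [T, Finset.mem_filter, Finset.mem_univ, true_and]
          exact ⟨fun h => h.trans h3.reachable, fun h => h.trans h3.symm.reachable⟩
        rw [← Finset.mul_sum]
        simp only [incidenceVector_apply, Int.cast_sub, Int.cast_ite, Int.cast_one, Int.cast_zero,
          Finset.sum_sub_distrib, Finset.sum_ite_eq, h2, sub_self, mul_zero]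
  rw [SimpleGraph.isBridge_iff_forall_cycle_notMem (hadj e he)] at hnb
  push Not at hnb
  obtain ⟨u, w, hw, hew⟩ := hnb
  refine ⟨u, w.mapLe hle, (SimpleGraph.Walk.isCycle_mapLe hle).2 hw, ?_, ?_⟩
  · rw [SimpleGraph.Walk.edges_mapLe_eq_edges, ← O.mk_eq e]
    exact hew
  · intro e' he'
    rw [SimpleGraph.Walk.edges_mapLe_eq_edges] at he'
    exact (hmem _ (w.edges_subset_edgeSet he')).2

/-- The flows are generated by the vectors of the cycles. -/
lemma flows_le_span [Finite V] : O.flows R ≤ Submodule.span R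
    {x | ∃ (u : V) (w : G.Walk u u), w.IsCycle ∧ x = fun e => (O.walkVec w e : R)} := by
  classical
  intro z hz
  induction hn : (Finset.univ.filter fun e => z e ≠ 0).card using Nat.strong_induction_on
    generalizing z with
  | _ n ih =>
  by_cases h0 : z = 0
  · rw [h0]; exact Submodule.zero_mem _
  obtain ⟨e, he⟩ := Function.ne_iff.1 h0
  obtain ⟨u, w, hw, hew, hsub⟩ := O.exists_isCycle_of_flow hz he
  set x : G.edgeSet → R := fun e => (O.walkVec w e : R) with hx
  have hxf : x ∈ O.flows R := O.cast_mem_flows (O.walkVec_mem_flows w)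
  have hxs : x ∈ Submodule.span R {x : G.edgeSet → R | ∃ (u : V) (w : G.Walk u u), w.IsCycle ∧
      x = fun e => (O.walkVec w e : R)} := Submodule.subset_span ⟨u, w, hw, rfl⟩
  have hxe : x e * x e = 1 := by
    rcases Int.isUnit_iff.1 (O.walkVec_isUnit w hw.isTrail hew) with h | h <;> simp [hx, h]
  -- As `x e` is `1` or `-1`, hence its own inverse, this multiple cancels the entry at `e`. The
  -- cycle runs inside the support of `z`, so no new entry appears and the support shrinks.
  have hmem : z - (z e * x e) • x ∈ O.flows R :=
    Submodule.sub_mem _ hz (Submodule.smul_mem _ _ hxf)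
  have := ih _ ?_ hmem rfl
  · have h2 := Submodule.add_mem _ this (Submodule.smul_mem _ (z e * x e) hxs)
    rwa [sub_add_cancel] at h2
  · rw [← hn]
    refine Finset.card_lt_card (Finset.ssubset_iff_subset_ne.2 ⟨?_, ?_⟩)
    · intro e' he'
      simp only [Finset.mem_filter, Finset.mem_univ, true_and] at he' ⊢
      by_cases h : (e' : Sym2 V) ∈ w.edges
      · exact hsub e' h
      · simpa [hx, O.walkVec_of_notMem w h] using he'
    · intro heq
      have : e ∈ Finset.univ.filter fun e => z e ≠ 0 := by simpa using he
      rw [← heq] at this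
      simp [mul_assoc, hxe] at this

/-- The space of flows of a graph with `q` edges, `n` vertices and `r` components has dimension
`q - n + r`. -/
lemma finrank_flows [Finite V] {K : Type*} [Field K] :
    Module.finrank K (O.flows K) + Nat.card V =
      Nat.card G.edgeSet + Nat.card G.ConnectedComponent := by
  classical
  cases nonempty_fintype V
  have := Fintype.ofFinite G.ConnectedComponent
  -- Rank-nullity is used for the incidence matrix, with the flows as kernel, and for its transpose,
  -- whose kernel consists of the functions constant on the components.
  let M : Matrix V G.edgeSet K := Matrix.of fun v e => (O.incidenceVector e v : K)
  have hM : O.boundary K = M.mulVecLin := by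
    ext z v
    simp [boundary_apply, M, Matrix.mulVec, dotProduct, mul_comm]
  have h1 : M.rank + Module.finrank K (O.flows K) = Nat.card G.edgeSet := by
    rw [flows, hM, Matrix.rank, LinearMap.finrank_range_add_finrank_ker]
    simp
  have h2 : M.rank + Module.finrank K (LinearMap.ker M.transpose.mulVecLin) = Nat.card V := by
    rw [← Matrix.rank_transpose, Matrix.rank, LinearMap.finrank_range_add_finrank_ker]
    simp
  let φ : (G.ConnectedComponent → K) →ₗ[K] (V → K) :=
    LinearMap.funLeft K K G.connectedComponentMk
  have hφ : Function.Injective φ :=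
    LinearMap.funLeft_injective_of_surjective K K _ Quot.mk_surjective
  have hker : LinearMap.range φ = LinearMap.ker M.transpose.mulVecLin := by
    ext f
    have hmul : ∀ e, M.transpose.mulVec f e = f (O.head e) - f (O.tail e) := by
      intro e
      simp [Matrix.mulVec, dotProduct, M, incidenceVector_apply, sub_mul, Finset.sum_sub_distrib]
    rw [LinearMap.mem_range, LinearMap.mem_ker, Matrix.mulVecLin_apply]
    constructor
    · rintro ⟨g, rfl⟩
      ext e
      rw [hmul]
      have hadj : G.Adj (O.tail e) (O.head e) := by
        have := e.2
        rwa [← O.mk_eq e] at this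
      have : G.connectedComponentMk (O.head e) = G.connectedComponentMk (O.tail e) :=
        SimpleGraph.ConnectedComponent.sound hadj.symm.reachable
      simp [φ, LinearMap.funLeft_apply, this]
    · intro hf
      have hadj : ∀ u v, G.Adj u v → f u = f v := by
        intro u v huv
        have h3 := congrFun hf ⟨s(u, v), huv⟩
        rw [hmul, Pi.zero_apply, sub_eq_zero] at h3
        have hmk := O.mk_eq ⟨s(u, v), huv⟩
        rw [Sym2.eq_iff] at hmk
        rcases hmk with ⟨h4, h5⟩ | ⟨h4, h5⟩
        · rw [h4, h5] at h3; exact h3.symm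
        · rw [h4, h5] at h3; exact h3
      refine ⟨fun c => c.lift f ?_, ?_⟩
      · intro u v p _
        induction p with
        | nil => rfl
        | cons h p ih => exact (hadj _ _ h).trans (ih (by simp_all))
      · ext v
        rfl
  rw [← hker, LinearMap.finrank_range_of_inj hφ] at h2
  simp only [Module.finrank_fintype_fun_eq_card] at h2
  rw [← Nat.card_eq_fintype_card] at h2
  omega

end GraphOrientation

/-! ### Congruence of monomials modulo an ideal -/

section Binomials

open MvPolynomial

variable {σ k : Type*} [Field k] {I : Ideal (MvPolynomial σ k)} {α β γ δ : σ →₀ ℕ}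

lemma pureBinomial_self_mem : pureBinomial k α α ∈ I := by
  rw [pureBinomial, sub_self]; exact I.zero_mem

lemma pureBinomial_mem_symm (h : pureBinomial k α β ∈ I) : pureBinomial k β α ∈ I := by
  have := I.neg_mem h
  rwa [pureBinomial, neg_sub] at this

lemma pureBinomial_mem_trans (h : pureBinomial k α β ∈ I) (h' : pureBinomial k β γ ∈ I) :
    pureBinomial k α γ ∈ I := by
  have := I.add_mem h h'
  rwa [pureBinomial, pureBinomial, sub_add_sub_cancel] at this

/-- Multiply the first binomial by `t^γ`, the second by `t^β`, and add. Congruence of monomials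
modulo an ideal is thus compatible with products. -/
lemma pureBinomial_mem_add (h : pureBinomial k α β ∈ I) (h' : pureBinomial k γ δ ∈ I) :
    pureBinomial k (α + γ) (β + δ) ∈ I := by
  have := I.add_mem (I.mul_mem_left (monomial γ 1) h) (I.mul_mem_left (monomial β 1) h')
  simp only [pureBinomial, mul_sub, monomial_mul, mul_one] at this ⊢
  rwa [add_comm γ α, add_comm γ β, sub_add_sub_cancel] at this

lemma pureBinomial_mem_nsmul (h : pureBinomial k α β ∈ I) (n : ℕ) :
    pureBinomial k (n • α) (n • β) ∈ I := by
  induction n with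
  | zero => simpa using pureBinomial_self_mem
  | succ n ih => rw [succ_nsmul, succ_nsmul]; exact pureBinomial_mem_add ih h

variable [Finite σ]

/-- The positive part of an integer vector, as an exponent. -/
noncomputable def posExp (x : σ → ℤ) : σ →₀ ℕ := Finsupp.equivFunOnFinite.symm fun e => (x e).toNat

@[simp] lemma posExp_apply (x : σ → ℤ) (e : σ) : posExp x e = (x e).toNat := rfl

lemma expDiff_posExp (x : σ → ℤ) : expDiff (posExp x) (posExp (-x)) = x := by
  ext e
  simp only [expDiff, posExp_apply, Pi.neg_apply]
  omega

/-- The ideal generated by the binomials of a set of integer vectors. -/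
noncomputable def vectorIdeal (k : Type*) [Field k] (Λ : Set (σ → ℤ)) : Ideal (MvPolynomial σ k) :=
  Ideal.span ((fun x => pureBinomial k (posExp x) (posExp (-x))) '' Λ)

lemma vectorIdeal_mono {Λ Λ' : Set (σ → ℤ)} (h : Λ ⊆ Λ') : vectorIdeal k Λ ≤ vectorIdeal k Λ' :=
  Ideal.span_mono (Set.image_mono h)

/-- Up to a common monomial factor, the binomial is the difference of the `n`-th powers of the two
monomials of `x`. The factor exists because the positive and negative parts of `x` have disjoint
supports, which forces `n • posExp x ≤ α`. -/
lemma pureBinomial_mem_of_expDiff_eq_nsmul {x : σ → ℤ}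
    (hx : pureBinomial k (posExp x) (posExp (-x)) ∈ I) (n : ℕ) (h : expDiff α β = n • x) :
    pureBinomial k α β ∈ I := by
  have h1 : ∀ e, (α e : ℤ) = β e + n * x e := by
    intro e
    have := congrFun h e
    simp only [expDiff, Pi.smul_apply, nsmul_eq_mul] at this
    linarith
  have h2 : ∀ e, (posExp x e : ℤ) - posExp (-x) e = x e := fun e => congrFun (expDiff_posExp x) e
  have h4 : n • posExp x ≤ α := by
    intro e
    have := h1 e
    rw [Finsupp.smul_apply, smul_eq_mul, posExp_apply]
    rcases le_total 0 (x e) with h5 | h5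
    · zify; rw [Int.toNat_of_nonneg h5]; omega
    · rw [Int.toNat_of_nonpos h5]; simp
  obtain ⟨γ, rfl⟩ := exists_add_of_le h4
  have h5 : β = n • posExp (-x) + γ := by
    ext e
    have h6 := h1 e
    rw [Finsupp.add_apply, Finsupp.smul_apply, smul_eq_mul, Nat.cast_add, Nat.cast_mul, ← h2 e]
      at h6
    rw [Finsupp.add_apply, Finsupp.smul_apply, smul_eq_mul]
    zify
    linarith
  rw [h5]
  exact pureBinomial_mem_add (pureBinomial_mem_nsmul hx n) pureBinomial_self_mem

lemma pureBinomial_mem_of_expDiff_eq_zsmul {x : σ → ℤ}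
    (hx : pureBinomial k (posExp x) (posExp (-x)) ∈ I) (c : ℤ) (h : expDiff α β = c • x) :
    pureBinomial k α β ∈ I := by
  obtain ⟨n, rfl | rfl⟩ := c.eq_nat_or_neg
  · exact pureBinomial_mem_of_expDiff_eq_nsmul hx n (by simpa using h)
  · refine pureBinomial_mem_symm (pureBinomial_mem_of_expDiff_eq_nsmul hx n ?_)
    have : expDiff β α = - expDiff α β := by ext; simp [expDiff]
    rw [this, h]
    simp

end Binomials

/-! ### Generating families of flows on sets of edges, and their gluing -/

namespace GraphOrientation

open MvPolynomial SimpleGraph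

variable {V : Type*} {G : SimpleGraph V}

open Classical in
/-- The exponent restricted to a set of edges. -/
noncomputable def restrictExp (F : Set (Sym2 V)) (α : G.edgeSet →₀ ℕ) : G.edgeSet →₀ ℕ :=
  α.filter fun e => (e : Sym2 V) ∈ F

open Classical in
lemma restrictExp_apply {F : Set (Sym2 V)} (α : G.edgeSet →₀ ℕ) (e : G.edgeSet) :
    restrictExp F α e = if (e : Sym2 V) ∈ F then α e else 0 := by
  simp [restrictExp, Finsupp.filter_apply]

lemma restrictExp_add_restrictExp_compl (F : Set (Sym2 V)) (α : G.edgeSet →₀ ℕ) :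
    restrictExp F α + restrictExp Fᶜ α = α := by
  classical
  ext e
  rw [Finsupp.add_apply, restrictExp_apply, restrictExp_apply]
  by_cases h : (e : Sym2 V) ∈ F <;> simp [h]

lemma restrictExp_supported {F : Set (Sym2 V)} (α : G.edgeSet →₀ ℕ) (e : G.edgeSet) (he : restrictExp F α e ≠ 0) :
    (e : Sym2 V) ∈ F := by
  classical
  rw [restrictExp_apply] at he
  by_contra h
  simp [h] at he

lemma restrictExp_compl_supported {F F₂ : Set (Sym2 V)} {α : G.edgeSet →₀ ℕ}
    (hα : ∀ e, α e ≠ 0 → (e : Sym2 V) ∈ F ∪ F₂) (e : G.edgeSet)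
    (he : restrictExp Fᶜ α e ≠ 0) : (e : Sym2 V) ∈ F₂ := by
  classical
  have h1 := restrictExp_supported α e he
  refine (hα e ?_).resolve_left h1
  rw [restrictExp_apply] at he
  simp only [ne_eq, ite_eq_right_iff, not_forall] at he
  exact he.2

variable (O : GraphOrientation G) [Fintype G.edgeSet]

/-- Reduction of an integer vector modulo `2`. -/
def modTwo {σ : Type*} : (σ → ℤ) →+ (σ → ZMod 2) where
  toFun x e := x e
  map_zero' := by ext; simp
  map_add' x y := by ext; simp

lemma modTwo_apply {σ : Type*} (x : σ → ℤ) (e : σ) : modTwo x e = x e := rfl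

lemma modTwo_mem_flows {x : G.edgeSet → ℤ} (hx : x ∈ O.flows ℤ) : modTwo x ∈ O.flows (ZMod 2) :=
  O.cast_mem_flows hx

/-- If binomials generate the toric ideal, then their vectors generate the flows modulo `2`. -/
lemma span_modTwo_eq_flows [Finite V] {k ι : Type*} [Field k] (a b : ι → G.edgeSet →₀ ℕ)
    (h : Ideal.span (Set.range fun i => pureBinomial k (a i) (b i)) = O.toricIdeal k) :
    Submodule.span (ZMod 2) (Set.range fun i => modTwo (expDiff (a i) (b i))) =
      O.flows (ZMod 2) := by
  apply le_antisymm
  · rw [Submodule.span_le]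
    rintro _ ⟨i, rfl⟩
    apply O.modTwo_mem_flows
    rw [← O.expBoundary_eq_iff, ← O.pureBinomial_mem_toricIdeal (k := k), ← h]
    exact Ideal.subset_span ⟨i, rfl⟩
  · refine O.flows_le_span.trans ?_
    rw [Submodule.span_le]
    rintro _ ⟨u, w, hw, rfl⟩
    -- The lattice `L` of integer vectors whose reductions lie in the span contains the differences
    -- of the generators, hence by `expDiff_mem_of_mem_span` those of all binomials in the toric
    -- ideal, in particular the cycle vectors.
    let L : AddSubgroup (G.edgeSet → ℤ) := (Submodule.span (ZMod 2)
      (Set.range fun i => modTwo (expDiff (a i) (b i)))).toAddSubgroup.comap modTwo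
    have h1 : expDiff (posExp (O.walkVec w)) (posExp (-O.walkVec w)) ∈ L := by
      refine expDiff_mem_of_mem_span (k := k)
        (S := Set.range fun i => pureBinomial k (a i) (b i)) ?_ ?_
      · rintro _ ⟨i, rfl⟩
        exact ⟨a i, b i, rfl, Submodule.subset_span ⟨i, rfl⟩⟩
      · rw [h, pureBinomial_mem_toricIdeal, expBoundary_eq_iff, expDiff_posExp]
        exact O.walkVec_mem_flows w
    rw [expDiff_posExp] at h1
    exact h1

variable {R : Type*} [CommRing R]

lemma sum_boundary [Fintype V] (z : G.edgeSet → R) : ∑ v, O.boundary R z v = 0 := by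
  classical
  simp only [boundary_apply]
  rw [Finset.sum_comm]
  refine Finset.sum_eq_zero fun e _ => ?_
  rw [← Finset.mul_sum]
  simp [incidenceVector_apply, Finset.sum_sub_distrib]

lemma boundary_eq_zero_of_notMem {z : G.edgeSet → R} {v : V}
    (h : ∀ e : G.edgeSet, z e ≠ 0 → v ∉ (e : Sym2 V)) : O.boundary R z v = 0 := by
  rw [boundary_apply]
  refine Finset.sum_eq_zero fun e _ => ?_
  by_cases hz : z e = 0
  · rw [hz, zero_mul]
  · rw [O.incidenceVector_of_notMem (h e hz), Int.cast_zero, mul_zero]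

/-- A flow that vanishes outside of a single edge is zero. -/
lemma eq_zero_of_supported_edge {z : G.edgeSet → R} (hz : z ∈ O.flows R) {e : G.edgeSet}
    (hs : ∀ e', z e' ≠ 0 → e' = e) : z = 0 := by
  have hadj : G.Adj (O.tail e) (O.head e) := by
    have := e.2
    rwa [← O.mk_eq e] at this
  have he : z e = 0 := by
    refine O.eq_zero_of_isPath hadj.toWalk (Walk.IsPath.of_adj hadj)
      (fun w _ _ => O.mem_flows.1 hz w) (fun e' he' => Or.inl ?_) e ?_
    · rw [hs e' he', ← O.mk_eq e]; simp
    · rw [← O.mk_eq e]; simp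
  ext e'
  by_contra h
  rw [hs e' h] at h
  exact h he

/-- A flow that vanishes outside of a cycle is a multiple of the vector of the cycle. -/
lemma eq_smul_walkVec {z : G.edgeSet → R} (hz : z ∈ O.flows R) {u : V} {w : G.Walk u u}
    (hw : w.IsCycle) (hs : ∀ e : G.edgeSet, z e ≠ 0 → (e : Sym2 V) ∈ w.edges) :
    ∃ c : R, z = c • fun e => (O.walkVec w e : R) := by
  set x : G.edgeSet → R := fun e => (O.walkVec w e : R) with hx
  have hxf : x ∈ O.flows R := O.cast_mem_flows (O.walkVec_mem_flows w)
  have hxs : ∀ e : G.edgeSet, (e : Sym2 V) ∉ w.edges → x e = 0 := by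
    intro e he
    simp [hx, O.walkVec_of_notMem w he]
  have hxe : ∀ e : G.edgeSet, (e : Sym2 V) ∈ w.edges → x e * x e = 1 := by
    intro e he
    rcases Int.isUnit_iff.1 (O.walkVec_isUnit w hw.isTrail he) with h | h <;> simp [hx, h]
  clear_value x
  cases w with
  | nil => exact absurd hw (by simp)
  | @cons _ a _ h p =>
    rw [Walk.cons_isCycle_iff] at hw
    set e₀ : G.edgeSet := ⟨s(u, a), h⟩ with he₀
    -- This multiple cancels the first edge of the cycle. The rest of the cycle is a path, which
    -- carries no nonzero flow.
    refine ⟨z e₀ * x e₀, ?_⟩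
    have hzf : z - (z e₀ * x e₀) • x ∈ O.flows R :=
      Submodule.sub_mem _ hz (Submodule.smul_mem _ _ hxf)
    have h0 : (z - (z e₀ * x e₀) • x) e₀ = 0 := by
      simp [mul_assoc, hxe e₀ (by simp [he₀])]
    have hsub : ∀ e : G.edgeSet, (z - (z e₀ * x e₀) • x) e ≠ 0 → (e : Sym2 V) ∈ p.edges := by
      intro e he
      by_contra hcon
      by_cases hee : e = e₀
      · exact he (hee ▸ h0)
      · have : (e : Sym2 V) ∉ (Walk.cons h p).edges := by
          rw [Walk.edges_cons, List.mem_cons, not_or]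
          exact ⟨fun h => hee (Subtype.ext h), hcon⟩
        apply he
        have h1 : z e = 0 := by
          by_contra h1
          exact this (hs e h1)
        simp [h1, hxs e this]
    have hall := O.eq_zero_of_isPath p hw.1 (fun w _ _ => O.mem_flows.1 hzf w)
      (fun e he => Or.inl (hsub e he))
    rw [← sub_eq_zero]
    ext e
    by_contra he
    exact he (hall e (hsub e he))

/-- The integer flows in the finite set `Λ` are supported on the set of edges `F`, independent modulo
`2`, and their binomials generate the binomials of the toric ideal in the edges of `F`. -/
structure GeneratesOn (k : Type*) [Field k] (F : Set (Sym2 V)) (Λ : Finset (G.edgeSet → ℤ)) :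
    Prop where
  mem_flows : ∀ x ∈ Λ, x ∈ O.flows ℤ
  supported : ∀ x ∈ Λ, ∀ e : G.edgeSet, x e ≠ 0 → (e : Sym2 V) ∈ F
  linearIndepOn : LinearIndepOn (ZMod 2) modTwo (Λ : Set (G.edgeSet → ℤ))
  generates : ∀ α β : G.edgeSet →₀ ℕ, (∀ e, α e ≠ 0 → (e : Sym2 V) ∈ F) →
    (∀ e, β e ≠ 0 → (e : Sym2 V) ∈ F) → expDiff α β ∈ O.flows ℤ →
    pureBinomial k α β ∈ vectorIdeal k (Λ : Set (G.edgeSet → ℤ))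

variable {O} {k : Type*} [Field k] {F F₁ F₂ : Set (Sym2 V)} {Λ Λ₁ Λ₂ : Finset (G.edgeSet → ℤ)}

/-- Needed for single vertices, bridges and the empty union of blocks. -/
lemma generatesOn_empty_of_flows_eq_zero
    (h : ∀ z ∈ O.flows ℤ, (∀ e : G.edgeSet, z e ≠ 0 → (e : Sym2 V) ∈ F) → z = 0) :
    O.GeneratesOn k F ∅ where
  mem_flows := by simp
  supported := by simp
  linearIndepOn := by simp
  generates α β hα hβ hf := by
    have : expDiff α β = 0 := by
      refine h _ hf fun e he => ?_
      by_contra hcon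
      have h1 : α e = 0 := by by_contra h1; exact hcon (hα e h1)
      have h2 : β e = 0 := by by_contra h2; exact hcon (hβ e h2)
      exact he (by simp [expDiff, h1, h2])
    rw [expDiff_eq_zero] at this
    rw [this]
    exact pureBinomial_self_mem

/-- All flows on a cycle are multiples of its vector, so a single binomial suffices. -/
lemma generatesOn_isCycle {u : V} {w : G.Walk u u} (hw : w.IsCycle) :
    O.GeneratesOn k {e | e ∈ w.edges} {O.walkVec w} where
  mem_flows := by
    simpa using O.walkVec_mem_flows w
  supported := by
    simp only [Finset.mem_singleton, forall_eq, Set.mem_ofPred_eq]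
    intro e he
    by_contra h
    exact he (O.walkVec_of_notMem w h)
  linearIndepOn := by
    rw [Finset.coe_singleton]
    refine LinearIndepOn.singleton ?_ 
    intro h0
    have h1 : modTwo (O.walkVec w) = w.edgeIndicator := O.walkVec_cast_eq_edgeIndicator w hw.isTrail
    cases w with
    | nil => exact absurd hw (by simp)
    | @cons _ a _ h p =>
      have h2 := congrFun (h1.symm.trans h0) ⟨s(u, a), h⟩
      simp [Walk.edgeIndicator] at h2
  generates α β hα hβ hf := by
    obtain ⟨c, hc⟩ := O.eq_smul_walkVec hf hw (fun e he => by
      by_contra hcon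
      have h1 : α e = 0 := by by_contra h1; exact hcon (hα e h1)
      have h2 : β e = 0 := by by_contra h2; exact hcon (hβ e h2)
      exact he (by simp [expDiff, h1, h2]))
    refine pureBinomial_mem_of_expDiff_eq_zsmul (x := O.walkVec w) ?_ c (by simpa using hc)
    exact Ideal.subset_span ⟨_, by simp, rfl⟩

/-- Two independent families of flows can be united, if a flow on the common edges is zero. -/
lemma GeneratesOn.union [DecidableEq (G.edgeSet → ℤ)]
    (h₁ : O.GeneratesOn k F₁ Λ₁) (h₂ : O.GeneratesOn k F₂ Λ₂)
    (hinter : ∀ z ∈ O.flows (ZMod 2), (∀ e : G.edgeSet, z e ≠ 0 → (e : Sym2 V) ∈ F₁ ∩ F₂) → z = 0)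
    (hgen : ∀ α β : G.edgeSet →₀ ℕ, (∀ e, α e ≠ 0 → (e : Sym2 V) ∈ F₁ ∪ F₂) →
      (∀ e, β e ≠ 0 → (e : Sym2 V) ∈ F₁ ∪ F₂) → expDiff α β ∈ O.flows ℤ →
      pureBinomial k α β ∈ vectorIdeal k ((Λ₁ : Set (G.edgeSet → ℤ)) ∪ Λ₂)) :
    O.GeneratesOn k (F₁ ∪ F₂) (Λ₁ ∪ Λ₂) where
  mem_flows x hx := by
    rcases Finset.mem_union.1 hx with h | h
    · exact h₁.mem_flows x h
    · exact h₂.mem_flows x h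
  supported x hx e he := by
    rcases Finset.mem_union.1 hx with h | h
    · exact Or.inl (h₁.supported x h e he)
    · exact Or.inr (h₂.supported x h e he)
  linearIndepOn := by
    rw [Finset.coe_union]
    refine h₁.linearIndepOn.union h₂.linearIndepOn ?_
    -- A vector in both spans is a flow supported on `F₁ ∩ F₂`, to which `hinter` applies.
    have key : ∀ {F : Set (Sym2 V)} {Λ : Finset (G.edgeSet → ℤ)}, O.GeneratesOn k F Λ →
        ∀ z ∈ Submodule.span (ZMod 2) (modTwo '' (Λ : Set (G.edgeSet → ℤ))),
          z ∈ O.flows (ZMod 2) ∧ ∀ e : G.edgeSet, z e ≠ 0 → (e : Sym2 V) ∈ F := by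
      intro F Λ h z hz
      induction hz using Submodule.span_induction with
      | mem x hx =>
        obtain ⟨y, hy, rfl⟩ := hx
        refine ⟨O.modTwo_mem_flows (h.mem_flows y hy), fun e he => h.supported y hy e ?_⟩
        rintro h0
        exact he (by rw [modTwo_apply, h0, Int.cast_zero])
      | zero => exact ⟨Submodule.zero_mem _, by simp⟩
      | add x y _ _ hx hy =>
        refine ⟨Submodule.add_mem _ hx.1 hy.1, fun e he => ?_⟩
        by_cases h0 : x e = 0
        · refine hy.2 e fun h1 => he ?_
          rw [Pi.add_apply, h0, h1, add_zero]
        · exact hx.2 e h0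
      | smul c x _ hx =>
        refine ⟨Submodule.smul_mem _ _ hx.1, fun e he => hx.2 e fun h0 => he ?_⟩
        rw [Pi.smul_apply, h0, smul_zero]
    rw [Submodule.disjoint_def]
    intro z hz1 hz2
    exact hinter z (key h₁ z hz1).1 fun e he => ⟨(key h₁ z hz1).2 e he, (key h₂ z hz2).2 e he⟩
  generates := by
    rw [Finset.coe_union]
    exact hgen

/-- Gluing of two disjoint sets of edges such that flows restrict to flows. -/
lemma GeneratesOn.union_of_disjoint [DecidableEq (G.edgeSet → ℤ)]
    (h₁ : O.GeneratesOn k F₁ Λ₁) (h₂ : O.GeneratesOn k F₂ Λ₂) (hd : Disjoint F₁ F₂)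
    (hres : ∀ z y : G.edgeSet → ℤ, z ∈ O.flows ℤ → (∀ e : G.edgeSet, (e : Sym2 V) ∈ F₁ → y e = z e) →
      (∀ e : G.edgeSet, (e : Sym2 V) ∉ F₁ → y e = 0) → y ∈ O.flows ℤ) :
    O.GeneratesOn k (F₁ ∪ F₂) (Λ₁ ∪ Λ₂) := by
  classical
  refine h₁.union h₂ ?_ ?_
  · intro z _ hz
    ext e
    by_contra h
    exact (Set.disjoint_iff.1 hd (hz e h)).elim
  · intro α β hα hβ hf
    have hf1 : expDiff (restrictExp F₁ α) (restrictExp F₁ β) ∈ O.flows ℤ := by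
      refine hres _ _ hf ?_ ?_ <;> intro e he <;> simp [expDiff, restrictExp_apply, he]
    have hf2 : expDiff (restrictExp F₁ᶜ α) (restrictExp F₁ᶜ β) ∈ O.flows ℤ := by
      have : expDiff (restrictExp F₁ᶜ α) (restrictExp F₁ᶜ β) =
          expDiff α β - expDiff (restrictExp F₁ α) (restrictExp F₁ β) := by
        ext e
        by_cases h : (e : Sym2 V) ∈ F₁ <;> simp [expDiff, restrictExp_apply, h]
      rw [this]
      exact Submodule.sub_mem _ hf hf1
    rw [← restrictExp_add_restrictExp_compl F₁ α, ← restrictExp_add_restrictExp_compl F₁ β]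
    refine pureBinomial_mem_add ?_ ?_
    · exact vectorIdeal_mono Set.subset_union_left
        (h₁.generates _ _ (restrictExp_supported α) (restrictExp_supported β) hf1)
    · exact vectorIdeal_mono Set.subset_union_right (h₂.generates _ _
        (restrictExp_compl_supported hα) (restrictExp_compl_supported hβ) hf2)

/-- Gluing of two sets of edges along a common edge. -/
lemma GeneratesOn.union_of_inter_edge [Finite V] [DecidableEq (G.edgeSet → ℤ)]
    (h₁ : O.GeneratesOn k F₁ Λ₁) (h₂ : O.GeneratesOn k F₂ Λ₂) (e₀ : G.edgeSet)
    (he₁ : (e₀ : Sym2 V) ∈ F₁) (he₂ : (e₀ : Sym2 V) ∈ F₂)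
    (hv : ∀ e₁ ∈ F₁, ∀ e₂ ∈ F₂, ∀ v, v ∈ e₁ → v ∈ e₂ → v ∈ (e₀ : Sym2 V)) :
    O.GeneratesOn k (F₁ ∪ F₂) (Λ₁ ∪ Λ₂) := by
  classical
  cases nonempty_fintype V
  refine h₁.union h₂ ?_ ?_
  · intro z hz hs
    refine O.eq_zero_of_supported_edge hz (e := e₀) fun e' he' => Subtype.ext ?_
    obtain ⟨hs1, hs2⟩ := hs e' he'
    have h3 : ∀ v, v ∈ (e' : Sym2 V) → v ∈ (e₀ : Sym2 V) := fun v h => hv _ hs1 _ hs2 v h h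
    have hne := O.tail_ne_head e'
    rw [(Sym2.mem_and_mem_iff hne).1 ⟨h3 _ (O.tail_mem e'), h3 _ (O.head_mem e')⟩]
    exact ((Sym2.mem_and_mem_iff hne).1 ⟨O.tail_mem e', O.head_mem e'⟩)
  · intro α β hα hβ hf
    set α₁ := restrictExp F₁ α with hα₁
    set β₁ := restrictExp F₁ β with hβ₁
    set α₂ := restrictExp F₁ᶜ α with hα₂
    set β₂ := restrictExp F₁ᶜ β with hβ₂
    have hsum : expDiff α₁ β₁ + expDiff α₂ β₂ = expDiff α β := by
      ext e
      by_cases h : (e : Sym2 V) ∈ F₁ <;>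
        simp [expDiff, hα₁, hβ₁, hα₂, hβ₂, restrictExp_apply, h]
    have hsα₁ := restrictExp_supported (F := F₁) α
    have hsβ₁ := restrictExp_supported (F := F₁) β
    have hsα₂ := restrictExp_compl_supported hα
    have hsβ₂ := restrictExp_compl_supported hβ
    have hbsum : ∀ v, O.boundary ℤ (expDiff α₁ β₁) v + O.boundary ℤ (expDiff α₂ β₂) v = 0 := by
      intro v
      rw [← Pi.add_apply, ← map_add, hsum]
      exact O.mem_flows.1 hf v
    set ε : G.edgeSet →₀ ℕ := Finsupp.single e₀ 1 with hε
    let x : G.edgeSet → ℤ := Pi.single e₀ 1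
    have hbx : ∀ v, O.boundary ℤ x v = O.incidenceVector e₀ v := by
      intro v
      rw [boundary_apply, Finset.sum_eq_single e₀]
      · simp [x]
      · intro b _ hb
        simp [x, Pi.single_eq_of_ne hb]
      · exact fun h => absurd (Finset.mem_univ _) h
    have hexp : ∀ {a b : G.edgeSet →₀ ℕ} {F : Set (Sym2 V)},
        (∀ e, a e ≠ 0 → (e : Sym2 V) ∈ F) → (∀ e, b e ≠ 0 → (e : Sym2 V) ∈ F) →
        ∀ e, expDiff a b e ≠ 0 → (e : Sym2 V) ∈ F := by
      intro a b F ha hb e he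
      by_contra hcon
      have h1 : a e = 0 := by by_contra h1; exact hcon (ha e h1)
      have h2 : b e = 0 := by by_contra h2; exact hcon (hb e h2)
      exact he (by simp [expDiff, h1, h2])
    -- The boundaries of the two parts are opposite, so a vertex where they do not vanish meets
    -- edges of both parts and is an end of `e₀`.
    have hout : ∀ v, v ∉ (e₀ : Sym2 V) → O.boundary ℤ (expDiff α₁ β₁) v = 0 := by
      intro v hve
      by_cases h1 : ∃ e : G.edgeSet, expDiff α₁ β₁ e ≠ 0 ∧ v ∈ (e : Sym2 V)
      · obtain ⟨e, he, hve'⟩ := h1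
        have h2 : O.boundary ℤ (expDiff α₂ β₂) v = 0 := by
          refine O.boundary_eq_zero_of_notMem fun e' he' hv' => hve ?_
          exact hv _ (hexp hsα₁ hsβ₁ e he) _ (hexp hsα₂ hsβ₂ e' he') v hve' hv'
        have := hbsum v
        rwa [h2, add_zero] at this
      · push Not at h1
        exact O.boundary_eq_zero_of_notMem h1
    -- The entries of a boundary add up to zero, so one concentrated on the two ends of `e₀` is a
    -- multiple of the boundary of `e₀`.
    obtain ⟨c, hc⟩ : ∃ c : ℤ, ∀ v, O.boundary ℤ (expDiff α₁ β₁) v = c * O.incidenceVector e₀ v := by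
      refine ⟨O.boundary ℤ (expDiff α₁ β₁) (O.head e₀), fun v => ?_⟩
      have hne := O.tail_ne_head e₀
      by_cases hve : v ∈ (e₀ : Sym2 V)
      · rcases (O.mem_edge_iff e₀ v).1 hve with rfl | rfl
        · have hs := O.sum_boundary (expDiff α₁ β₁)
          rw [← Finset.sum_subset (Finset.subset_univ {O.tail e₀, O.head e₀}),
            Finset.sum_pair hne] at hs
          · rw [incidenceVector_apply, if_neg hne.symm, if_pos rfl]
            linarith
          · intro v _ hv'
            refine hout v fun h => hv' ?_
            simpa using (O.mem_edge_iff e₀ v).1 h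
        · rw [incidenceVector_apply, if_neg hne, if_pos rfl]
          ring
      · rw [hout v hve, O.incidenceVector_of_notMem hve, mul_zero]
    have hflow1 : expDiff α₁ β₁ - c • x ∈ O.flows ℤ := by
      rw [O.mem_flows]
      intro v
      rw [map_sub, map_smul, Pi.sub_apply, Pi.smul_apply, hbx, hc]
      simp
    have hflow2 : expDiff α₂ β₂ + c • x ∈ O.flows ℤ := by
      have : expDiff α₂ β₂ + c • x = expDiff α β - (expDiff α₁ β₁ - c • x) := by
        rw [← hsum]; abel
      rw [this]
      exact Submodule.sub_mem _ hf hflow1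
    have hsup : ∀ {a : G.edgeSet →₀ ℕ} {F : Set (Sym2 V)} (n : ℕ),
        (∀ e, a e ≠ 0 → (e : Sym2 V) ∈ F) → (e₀ : Sym2 V) ∈ F →
        ∀ e, (a + n • ε) e ≠ 0 → (e : Sym2 V) ∈ F := by
      intro a F n ha h0 e he
      by_cases hee : e = e₀
      · rwa [hee]
      · refine ha e fun h => he ?_
        simp [h, hε, Ne.symm hee]
    have hxε : ∀ n : ℕ, ∀ e, ((n : ℤ) • x) e = ((n • ε) e : ℤ) := by
      intro n e
      by_cases hee : e = e₀
      · simp [x, hε, hee]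
      · simp [x, hε, hee]
    rw [← restrictExp_add_restrictExp_compl F₁ α, ← restrictExp_add_restrictExp_compl F₁ β]
    have hm1 := vectorIdeal_mono (k := k)
      (Set.subset_union_left : (Λ₁ : Set (G.edgeSet → ℤ)) ⊆ Λ₁ ∪ Λ₂)
    have hm2 := vectorIdeal_mono (k := k)
      (Set.subset_union_right : (Λ₂ : Set (G.edgeSet → ℤ)) ⊆ Λ₁ ∪ Λ₂)
    -- Exponents cannot be negative, so the sign of `c` decides the order: the part rewritten first
    -- produces `n` copies of `e₀`, and the other part uses them up.
    obtain ⟨n, rfl | rfl⟩ := c.eq_nat_or_neg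
    · have m1 : pureBinomial k α₁ (β₁ + n • ε) ∈ vectorIdeal k (Λ₁ : Set (G.edgeSet → ℤ)) := by
        refine h₁.generates _ _ hsα₁ (hsup n hsβ₁ he₁) ?_
        convert hflow1 using 1
        ext e
        rw [Pi.sub_apply, hxε]
        simp [expDiff]; ring
      have m2 : pureBinomial k (α₂ + n • ε) β₂ ∈ vectorIdeal k (Λ₂ : Set (G.edgeSet → ℤ)) := by
        refine h₂.generates _ _ (hsup n hsα₂ he₂) hsβ₂ ?_
        convert hflow2 using 1
        ext e
        rw [Pi.add_apply, hxε]
        simp [expDiff]; ring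
      refine pureBinomial_mem_trans (pureBinomial_mem_add (hm1 m1) pureBinomial_self_mem) ?_
      rw [add_assoc, add_comm (n • ε)]
      exact pureBinomial_mem_add pureBinomial_self_mem (hm2 m2)
    · have m1 : pureBinomial k (α₁ + n • ε) β₁ ∈ vectorIdeal k (Λ₁ : Set (G.edgeSet → ℤ)) := by
        refine h₁.generates _ _ (hsup n hsα₁ he₁) hsβ₁ ?_
        convert hflow1 using 1
        ext e
        rw [Pi.sub_apply, neg_smul, Pi.neg_apply, hxε]
        simp [expDiff]; ring
      have m2 : pureBinomial k α₂ (β₂ + n • ε) ∈ vectorIdeal k (Λ₂ : Set (G.edgeSet → ℤ)) := by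
        refine h₂.generates _ _ hsα₂ (hsup n hsβ₂ he₂) ?_
        convert hflow2 using 1
        ext e
        rw [Pi.add_apply, neg_smul, Pi.neg_apply, hxε]
        simp [expDiff]; ring
      refine pureBinomial_mem_trans (pureBinomial_mem_add pureBinomial_self_mem (hm2 m2)) ?_
      rw [add_comm β₂, ← add_assoc]
      exact pureBinomial_mem_add (hm1 m1) pureBinomial_self_mem

/-- Flows that generate the whole toric ideal make it a binomial complete intersection. -/
lemma GeneratesOn.isBinomialCompleteIntersection [Finite V]
    (h : O.GeneratesOn k Set.univ Λ) : IsBinomialCompleteIntersection k O := by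
  classical
  let S : Finset (MvPolynomial G.edgeSet k) :=
    Λ.image fun x => pureBinomial k (posExp x) (posExp (-x))
  have hspan : Ideal.span (S : Set (MvPolynomial G.edgeSet k)) = O.toricIdeal k := by
    apply le_antisymm
    · rw [Ideal.span_le]
      intro f hf
      simp only [S, Finset.coe_image] at hf
      obtain ⟨x, hx, rfl⟩ := hf
      rw [SetLike.mem_coe, pureBinomial_mem_toricIdeal, expBoundary_eq_iff, expDiff_posExp]
      exact h.mem_flows x hx
    · refine O.toricIdeal_le fun α β hαβ => ?_
      have := h.generates α β (by simp) (by simp) (O.expBoundary_eq_iff.1 hαβ)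
      rwa [vectorIdeal, ← Finset.coe_image] at this
  have hne : ∀ x ∈ Λ, posExp x ≠ posExp (-x) := by
    intro x hx h0
    have h1 := expDiff_posExp x
    rw [h0, expDiff_eq_zero.2 rfl] at h1
    refine h.linearIndepOn.ne_zero hx ?_
    rw [← h1, map_zero]
  -- Independence of `Λ` bounds the number of binomials from above, and spanning of the flows modulo
  -- `2` bounds it from below. Distinctness of the binomials of distinct vectors is therefore not
  -- needed beforehand.
  have hle : S.card ≤ Module.finrank (ZMod 2) (O.flows (ZMod 2)) := by
    refine Finset.card_image_le.trans ?_
    have h1 : LinearIndependent (ZMod 2) fun x : Λ =>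
        (⟨modTwo x.1, O.modTwo_mem_flows (h.mem_flows x.1 x.2)⟩ : O.flows (ZMod 2)) :=
      LinearIndependent.of_comp (O.flows (ZMod 2)).subtype h.linearIndepOn
    have := h1.fintype_card_le_finrank
    simpa using this
  have hge : Module.finrank (ZMod 2) (O.flows (ZMod 2)) ≤ S.card := by
    have hS : ∀ f : S, ∃ x : G.edgeSet → ℤ, pureBinomial k (posExp x) (posExp (-x)) = f.1 := by
      intro f
      obtain ⟨x, _, hx⟩ := Finset.mem_image.1 f.2
      exact ⟨x, hx⟩
    choose x hx using hS
    have h1 := O.span_modTwo_eq_flows (k := k) (fun f : S => posExp (x f))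
      (fun f : S => posExp (-x f)) (by
        simp only [hx]
        rw [← hspan]
        simp)
    rw [← h1]
    have := finrank_range_le_card (R := ZMod 2)
      (fun f : S => modTwo (expDiff (posExp (x f)) (posExp (-x f))))
    simpa [Set.finrank] using this
  refine ⟨S, ?_, ?_, hspan⟩
  · have := O.finrank_flows (K := ZMod 2)
    have h2 := le_antisymm hle hge
    omega
  · intro f hf
    obtain ⟨x, hx, rfl⟩ := Finset.mem_image.1 hf
    exact ⟨_, _, hne x hx, rfl⟩

end GraphOrientation

/-! ### Nonseparable subgraphs, blocks and `2`-clique-sums -/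

namespace SimpleGraph

variable {V : Type*} {G : SimpleGraph V}

namespace Subgraph

/-- Expressed by walks of `G` itself, which can be cut and joined without passing to deleted
subgraphs. -/
lemma isNonseparable_iff {H : G.Subgraph} : H.IsNonseparable ↔ H.verts.Nonempty ∧
    (∀ a ∈ H.verts, ∀ b ∈ H.verts, ∃ p : G.Walk a b, p.toSubgraph ≤ H) ∧
    ∀ v ∈ H.verts, ∀ a ∈ H.verts, ∀ b ∈ H.verts, a ≠ v → b ≠ v →
      ∃ p : G.Walk a b, p.toSubgraph ≤ H ∧ v ∉ p.support := by
  rw [IsNonseparable, connected_iff_forall_exists_walk_subgraph, and_assoc]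
  refine and_congr Iff.rfl (and_congr ⟨fun h a ha b hb => h ha hb, fun h a b ha hb => h a ha b hb⟩
    (forall₂_congr fun v hv => ?_))
  rw [preconnected_iff_forall_exists_walk_subgraph]
  constructor
  · intro h a ha b hb hav hbv
    obtain ⟨p, hp⟩ := h (u := a) (v := b) ⟨ha, hav⟩ ⟨hb, hbv⟩
    refine ⟨p, hp.trans deleteVerts_le, fun hvp => ?_⟩
    exact (hp.1 (p.mem_verts_toSubgraph.2 hvp)).2 rfl
  · rintro h a b ⟨ha, hav⟩ ⟨hb, hbv⟩
    obtain ⟨p, hp, hvp⟩ := h a ha b hb hav hbv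
    refine ⟨p, ⟨fun x hx => ⟨hp.1 hx, ?_⟩, fun x y hxy => ?_⟩⟩
    · rintro rfl
      exact hvp (p.mem_verts_toSubgraph.1 hx)
    · rw [deleteVerts_adj]
      have hx := p.mem_verts_toSubgraph.1 (p.toSubgraph.edge_vert hxy)
      have hy := p.mem_verts_toSubgraph.1 (p.toSubgraph.edge_vert hxy.symm)
      refine ⟨hp.1 (p.mem_verts_toSubgraph.2 hx), ?_, hp.1 (p.mem_verts_toSubgraph.2 hy), ?_,
        hp.2 hxy⟩
      · rintro rfl; exact hvp hx
      · rintro rfl; exact hvp hy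

/-- The union of two nonseparable subgraphs with two common vertices is nonseparable. -/
lemma IsNonseparable.sup {H K : G.Subgraph} (hH : H.IsNonseparable) (hK : K.IsNonseparable)
    {a b : V} (hab : a ≠ b) (haH : a ∈ H.verts) (haK : a ∈ K.verts) (hbH : b ∈ H.verts)
    (hbK : b ∈ K.verts) : (H ⊔ K).IsNonseparable := by
  have hdel : ∀ {L : G.Subgraph}, L.IsNonseparable → ∀ v, (L.deleteVerts {v}).Preconnected := by
    intro L hL v
    by_cases hv : v ∈ L.verts
    · exact hL.2 v hv
    · have : L.deleteVerts {v} = L := by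
        rw [← deleteVerts_inter_verts_left_eq, Set.inter_singleton_eq_empty.2 hv,
          deleteVerts_empty]
      rw [this]
      exact hL.1.preconnected
  refine ⟨connected_sup hH.1.preconnected hK.1.preconnected ⟨a, haH, haK⟩, fun v _ => ?_⟩
  have hsup : (H ⊔ K).deleteVerts {v} = H.deleteVerts {v} ⊔ K.deleteVerts {v} := by
    ext x y
    · simp only [deleteVerts_verts, verts_sup, Set.mem_sdiff, Set.mem_union]
      tauto
    · simp only [deleteVerts_adj, verts_sup, sup_adj, Set.mem_union]
      constructor
      · rintro ⟨_, h1, _, h2, h3 | h3⟩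
        · exact Or.inl ⟨H.edge_vert h3, h1, H.edge_vert h3.symm, h2, h3⟩
        · exact Or.inr ⟨K.edge_vert h3, h1, K.edge_vert h3.symm, h2, h3⟩
      · tauto
  rw [hsup]
  refine (connected_sup (hdel hH v) (hdel hK v) ?_).preconnected
  -- At least one of `a` and `b` survives the deletion of `v` and still links the two parts.
  by_cases hav : a = v
  · exact ⟨b, ⟨hbH, fun h => hab (hav.trans (Eq.symm h))⟩, ⟨hbK, fun h => hab (hav.trans (Eq.symm h))⟩⟩
  · exact ⟨a, ⟨haH, hav⟩, ⟨haK, hav⟩⟩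

lemma isNonseparable_subgraphOfAdj {u v : V} (h : G.Adj u v) :
    (G.subgraphOfAdj h).IsNonseparable := by
  refine ⟨subgraphOfAdj_connected h, fun w hw => ?_⟩
  rw [preconnected_iff_forall_exists_walk_subgraph]
  rintro a b ⟨ha, haw⟩ ⟨hb, hbw⟩
  have hab : a = b := by
    simp only [subgraphOfAdj_verts, Set.mem_insert_iff, Set.mem_singleton_iff] at *
    grind
  subst hab
  exact ⟨.nil, by simpa using ⟨ha, haw⟩⟩

/-- Rotate the cycle so that it starts at the deleted vertex. What remains is a path, and all its
vertices are reached from its beginning. -/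
lemma isNonseparable_toSubgraph_of_isCycle {u : V} {w : G.Walk u u} (hw : w.IsCycle) :
    w.toSubgraph.IsNonseparable := by
  classical
  refine ⟨w.toSubgraph_connected, fun v hv => ?_⟩
  rw [Walk.mem_verts_toSubgraph] at hv
  have hr := hw.rotate hv
  rw [← w.toSubgraph_rotate hv]
  generalize w.rotate v hv = c at hr
  cases c with
  | nil => exact absurd hr (by simp)
  | @cons _ a _ h p =>
    rw [Walk.cons_isCycle_iff] at hr
    rw [preconnected_iff_forall_exists_walk_subgraph]
    have key : ∀ x, x ∈ ((Walk.cons h p).toSubgraph.deleteVerts {v}).verts →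
        ∃ q : G.Walk a x, q.toSubgraph ≤ (Walk.cons h p).toSubgraph.deleteVerts {v} := by
      rintro x ⟨hx, hxv⟩
      rw [Walk.mem_verts_toSubgraph, Walk.support_cons, List.mem_cons] at hx
      have hxp : x ∈ p.support := hx.resolve_left hxv
      have hvn : v ∉ (p.takeUntil x hxp).support :=
        Walk.endpoint_notMem_support_takeUntil hr.1 hxp (Ne.symm hxv)
      refine ⟨p.takeUntil x hxp, ⟨fun y hy => ?_, fun y z hyz => ?_⟩⟩
      · rw [Walk.mem_verts_toSubgraph] at hy
        refine ⟨?_, ?_⟩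
        · rw [Walk.mem_verts_toSubgraph, Walk.support_cons]
          exact List.mem_cons_of_mem _ (p.support_takeUntil_subset_support hxp hy)
        · rintro rfl; exact hvn hy
      · have hy := (Walk.mem_verts_toSubgraph _).1 (Subgraph.edge_vert _ hyz)
        have hz := (Walk.mem_verts_toSubgraph _).1 (Subgraph.edge_vert _ hyz.symm)
        rw [deleteVerts_adj]
        refine ⟨?_, ?_, ?_, ?_, ?_⟩
        · rw [Walk.mem_verts_toSubgraph, Walk.support_cons]
          exact List.mem_cons_of_mem _ (p.support_takeUntil_subset_support hxp hy)
        · rintro rfl; exact hvn hy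
        · rw [Walk.mem_verts_toSubgraph, Walk.support_cons]
          exact List.mem_cons_of_mem _ (p.support_takeUntil_subset_support hxp hz)
        · rintro rfl; exact hvn hz
        · rw [Walk.adj_toSubgraph_iff_mem_edges] at hyz ⊢
          rw [Walk.edges_cons]
          exact List.mem_cons_of_mem _ (p.edges_takeUntil_subset_edges hxp hyz)
    intro x y hx hy
    obtain ⟨q, hq⟩ := key x hx
    obtain ⟨q', hq'⟩ := key y hy
    refine ⟨q.reverse.append q', ?_⟩
    rw [Walk.toSubgraph_append, Walk.toSubgraph_reverse]
    exact sup_le hq hq'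

/-- With two common vertices the union is nonseparable, so maximality of the block absorbs `H`. -/
lemma IsGraphBlock.sup_le {B H : G.Subgraph} (hB : B.IsGraphBlock) (hH : H.IsNonseparable)
    {a b : V} (hab : a ≠ b) (haB : a ∈ B.verts) (haH : a ∈ H.verts) (hbB : b ∈ B.verts)
    (hbH : b ∈ H.verts) : H ≤ B :=
  le_sup_right.trans (hB.2 (hB.1.sup hH hab haB haH hbB hbH) le_sup_left)

/-- Two blocks with a common edge are equal. -/
lemma IsGraphBlock.eq_of_mem_edgeSet {B B' : G.Subgraph} (hB : B.IsGraphBlock)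
    (hB' : B'.IsGraphBlock) {e : Sym2 V} (he : e ∈ B.edgeSet) (he' : e ∈ B'.edgeSet) : B = B' := by
  induction e with
  | h a b =>
    rw [Subgraph.mem_edgeSet] at he he'
    exact le_antisymm
      (hB'.sup_le hB.1 he.ne (B'.edge_vert he') (B.edge_vert he) (B'.edge_vert he'.symm)
        (B.edge_vert he.symm))
      (hB.sup_le hB'.1 he.ne (B.edge_vert he) (B'.edge_vert he') (B.edge_vert he.symm)
        (B'.edge_vert he'.symm))

lemma IsNonseparable.exists_isGraphBlock [Finite V] {H : G.Subgraph} (hH : H.IsNonseparable) :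
    ∃ B : G.Subgraph, B.IsGraphBlock ∧ H ≤ B := by
  obtain ⟨B, hHB, hB⟩ := Finite.exists_le_maximal (p := fun H : G.Subgraph => H.IsNonseparable) hH
  exact ⟨B, hB, hHB⟩

/-- The common edge of the two parts of a `2`-clique-sum. -/
lemma IsCliqueSum.exists_adj {H₁ H₂ H : G.Subgraph} (h : IsCliqueSum 2 H₁ H₂ H) :
    ∃ a b, H₁.Adj a b ∧ H₂.Adj a b ∧ ∀ v, v ∈ H₁.verts → v ∈ H₂.verts → v = a ∨ v = b := by
  obtain ⟨-, h2, h3⟩ := h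
  obtain ⟨a, b, hab, hv⟩ := Set.encard_eq_two.1 h2
  have ha : a ∈ (H₁ ⊓ H₂).verts := by rw [hv]; simp
  have hb : b ∈ (H₁ ⊓ H₂).verts := by rw [hv]; simp
  have hadj : (H₁ ⊓ H₂).coe.Adj ⟨a, ha⟩ ⟨b, hb⟩ := by
    rw [h3, SimpleGraph.top_adj]
    exact fun h => hab (congrArg Subtype.val h)
  refine ⟨a, b, hadj.1, hadj.2, fun v hv1 hv2 => ?_⟩
  have : v ∈ (H₁ ⊓ H₂).verts := ⟨hv1, hv2⟩
  rw [hv] at this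
  simpa using this

lemma isCliqueSum_two {H₁ H₂ : G.Subgraph} {a b : V} (h₁ : H₁.Adj a b) (h₂ : H₂.Adj a b)
    (h : ∀ v, v ∈ H₁.verts → v ∈ H₂.verts → v = a ∨ v = b) : IsCliqueSum 2 H₁ H₂ (H₁ ⊔ H₂) := by
  have hv : (H₁ ⊓ H₂).verts = {a, b} := by
    ext v
    simp only [verts_inf, Set.mem_inter_iff, Set.mem_insert_iff, Set.mem_singleton_iff]
    constructor
    · rintro ⟨h1, h2⟩; exact h v h1 h2
    · rintro (rfl | rfl)
      · exact ⟨H₁.edge_vert h₁, H₂.edge_vert h₂⟩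
      · exact ⟨H₁.edge_vert h₁.symm, H₂.edge_vert h₂.symm⟩
  refine ⟨rfl, ?_, ?_⟩
  · rw [hv, Set.encard_pair h₁.ne]; rfl
  · ext ⟨x, hx⟩ ⟨y, hy⟩
    rw [coe_adj, SimpleGraph.top_adj, ne_eq, Subtype.mk.injEq]
    constructor
    · exact fun h => h.ne
    · intro hne
      rw [hv] at hx hy
      simp only [Set.mem_insert_iff, Set.mem_singleton_iff] at hx hy
      rcases hx with rfl | rfl <;> rcases hy with rfl | rfl
      · exact absurd rfl hne
      · exact ⟨h₁, h₂⟩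
      · exact ⟨h₁.symm, h₂.symm⟩
      · exact absurd rfl hne

end Subgraph

end SimpleGraph

/-! ### Ring graphs have complete intersection toric ideals -/

namespace GraphOrientation

open SimpleGraph

variable {V : Type*} {G : SimpleGraph V} (O : GraphOrientation G) [Fintype G.edgeSet]

/-- Each `2`-clique-sum adds the vector of the new cycle, glued along the common edge. -/
lemma exists_generatesOn_of_isTwoSumOfCycles [Finite V] (k : Type*) [Field k] {B : G.Subgraph}
    (hB : B.IsTwoSumOfCycles) : ∃ Λ, O.GeneratesOn k B.edgeSet Λ := by
  classical
  have hcyc : ∀ C : G.Subgraph, C.IsCycleSubgraph → ∃ Λ, O.GeneratesOn k C.edgeSet Λ := by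
    rintro C ⟨u, w, hw, rfl⟩
    refine ⟨{O.walkVec w}, ?_⟩
    have : w.toSubgraph.edgeSet = {e | e ∈ w.edges} := by
      ext e
      exact w.mem_edges_toSubgraph
    rw [this]
    exact generatesOn_isCycle hw
  induction hB with
  | cycle C hC => exact hcyc C hC
  | sum H C H' _ hC hsum ih =>
    obtain ⟨Λ₁, h₁⟩ := ih
    obtain ⟨Λ₂, h₂⟩ := hcyc C hC
    obtain ⟨a, b, hH, hC', hv⟩ := hsum.exists_adj
    refine ⟨Λ₁ ∪ Λ₂, ?_⟩
    rw [hsum.1, Subgraph.edgeSet_sup]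
    refine h₁.union_of_inter_edge h₂ ⟨s(a, b), hH.adj_sub⟩ hH hC' fun e₁ he₁ e₂ he₂ v hv₁ hv₂ => ?_
    have := hv v (H.mem_verts_of_mem_edge he₁ hv₁) (C.mem_verts_of_mem_edge he₂ hv₂)
    simpa using this

/-- The restriction of a flow to a block is a flow. -/
lemma restrict_block_mem_flows [Finite V] {R : Type*} [CommRing R] {B : G.Subgraph}
    (hB : B.IsGraphBlock) {z y : G.edgeSet → R} (hz : z ∈ O.flows R)
    (hy : ∀ e : G.edgeSet, (e : Sym2 V) ∈ B.edgeSet → y e = z e)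
    (hy' : ∀ e : G.edgeSet, (e : Sym2 V) ∉ B.edgeSet → y e = 0) : y ∈ O.flows R := by
  classical
  let r : (G.edgeSet → R) →ₗ[R] (G.edgeSet → R) :=
    { toFun := fun z e => if (e : Sym2 V) ∈ B.edgeSet then z e else 0
      map_add' := by intro x y; ext e; simp only [Pi.add_apply]; split_ifs <;> simp
      map_smul' := by intro c x; ext e; simp }
  -- It suffices to restrict cycle vectors. A cycle is nonseparable and lies in one block, and
  -- distinct blocks share no edge, so its restriction is either itself or zero.
  have hle : O.flows R ≤ (O.flows R).comap r := by
    refine O.flows_le_span.trans ?_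
    rw [Submodule.span_le]
    rintro _ ⟨u, w, hw, rfl⟩
    set x : G.edgeSet → R := fun e => (O.walkVec w e : R) with hx
    have hxf : x ∈ O.flows R := O.cast_mem_flows (O.walkVec_mem_flows w)
    have hxs : ∀ e : G.edgeSet, (e : Sym2 V) ∉ w.edges → x e = 0 := by
      intro e he
      simp [hx, O.walkVec_of_notMem w he]
    obtain ⟨B₀, hB₀, hle⟩ :=
      (Subgraph.isNonseparable_toSubgraph_of_isCycle hw).exists_isGraphBlock
    have hmem : ∀ e ∈ w.edges, e ∈ B₀.edgeSet := fun e he =>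
      Subgraph.edgeSet_mono hle (w.mem_edges_toSubgraph.2 he)
    rw [SetLike.mem_coe, Submodule.mem_comap]
    by_cases hBB : B = B₀
    · convert hxf using 1
      ext e
      simp only [r, LinearMap.coe_mk, AddHom.coe_mk]
      split_ifs with h
      · rfl
      · exact (hxs e fun h' => h (hBB ▸ hmem _ h')).symm
    · convert Submodule.zero_mem _ using 1
      ext e
      simp only [r, LinearMap.coe_mk, AddHom.coe_mk, Pi.zero_apply]
      split_ifs with h
      · exact hxs e fun h' => hBB (hB.eq_of_mem_edgeSet hB₀ h (hmem _ h'))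
      · rfl
  have hry : r z = y := by
    ext e
    simp only [r, LinearMap.coe_mk, AddHom.coe_mk]
    split_ifs with h
    · exact (hy e h).symm
    · exact (hy' e h).symm
  rw [← hry]
  exact hle hz

/-- The blocks partition the edges and flows restrict to blocks, so the families are united one
block at a time. -/
lemma exists_generatesOn_univ [Finite V] (k : Type*) [Field k]
    (h : ∀ B : G.Subgraph, B.IsGraphBlock → ∃ Λ, O.GeneratesOn k B.edgeSet Λ) :
    ∃ Λ, O.GeneratesOn k Set.univ Λ := by
  classical
  have key : ∀ s : Finset G.Subgraph, (∀ B ∈ s, B.IsGraphBlock) →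
      ∃ Λ, O.GeneratesOn k (⋃ B ∈ s, B.edgeSet) Λ := by
    intro s
    induction s using Finset.induction_on with
    | empty =>
      intro _
      refine ⟨∅, generatesOn_empty_of_flows_eq_zero fun z _ hz => ?_⟩
      ext e
      by_contra he
      simpa using hz e he
    | insert B s hBs ih =>
      intro hs
      obtain ⟨Λ₁, h₁⟩ := h B (hs B (Finset.mem_insert_self _ _))
      obtain ⟨Λ₂, h₂⟩ := ih fun B' hB' => hs B' (Finset.mem_insert_of_mem hB')
      refine ⟨Λ₁ ∪ Λ₂, ?_⟩
      rw [Finset.set_biUnion_insert]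
      refine h₁.union_of_disjoint h₂ ?_ fun z y hz hy hy' =>
        O.restrict_block_mem_flows (hs B (Finset.mem_insert_self _ _)) hz hy hy'
      rw [Set.disjoint_left]
      intro e he he'
      simp only [Set.mem_iUnion] at he'
      obtain ⟨B', hB', he'⟩ := he'
      have := (hs B (Finset.mem_insert_self _ _)).eq_of_mem_edgeSet
        (hs B' (Finset.mem_insert_of_mem hB')) he he'
      exact hBs (this ▸ hB')
  have hfin : {B : G.Subgraph | B.IsGraphBlock}.Finite := Set.toFinite _
  obtain ⟨Λ, hΛ⟩ := key hfin.toFinset fun B hB => by simpa using hB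
  refine ⟨Λ, hΛ.mem_flows, by simp, hΛ.linearIndepOn, fun α β _ _ hf => ?_⟩
  have hall : ∀ e : G.edgeSet, (e : Sym2 V) ∈ ⋃ B ∈ hfin.toFinset, B.edgeSet := by
    intro e
    have hadj : G.Adj (O.tail e) (O.head e) := by
      have := e.2
      rwa [← O.mk_eq e] at this
    obtain ⟨B, hB, hle⟩ := (Subgraph.isNonseparable_subgraphOfAdj hadj).exists_isGraphBlock
    simp only [Set.mem_iUnion]
    refine ⟨B, by simpa using hB, Subgraph.edgeSet_mono hle ?_⟩
    rw [edgeSet_subgraphOfAdj, O.mk_eq]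
    rfl
  exact hΛ.generates α β (fun e _ => hall e) (fun e _ => hall e) hf

theorem isCIOGraph_of_isRingGraph {V : Type*} [Finite V] {G : SimpleGraph V} (k : Type*) [Field k]
    (hG : G.IsRingGraph) : G.IsCIOGraph k := by
  classical
  intro O
  have := Fintype.ofFinite G.edgeSet
  obtain ⟨Λ, hΛ⟩ := O.exists_generatesOn_univ k fun B hB => by
    by_cases h1 : B.IsVertex
    · obtain ⟨v, rfl⟩ := h1
      refine ⟨∅, generatesOn_empty_of_flows_eq_zero fun z _ hz => ?_⟩
      ext e
      by_contra he
      simpa using hz e he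
    · by_cases h2 : B.IsBridgeEdge
      · obtain ⟨u, v, h, -, rfl⟩ := h2
        refine ⟨∅, generatesOn_empty_of_flows_eq_zero fun z hzf hz => ?_⟩
        refine O.eq_zero_of_supported_edge hzf (e := ⟨s(u, v), h⟩) fun e he => ?_
        exact Subtype.ext (by simpa using hz e he)
      · exact O.exists_generatesOn_of_isTwoSumOfCycles k (hG B hB h1 h2)
  exact hΛ.isBinomialCompleteIntersection

end GraphOrientation

/-! ### Bipartite graphs: binomials of chordless cycles cannot be avoided -/

-- Compare the coefficients at `a` and at `b`. The exchanged case is possible only in characteristic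
-- two.
open MvPolynomial in
lemma eq_and_eq_of_pureBinomial_eq {σ k : Type*} [Field k] {a b α β : σ →₀ ℕ} (hab : a ≠ b)
    (h : pureBinomial k a b = pureBinomial k α β) : a = α ∧ b = β ∨ a = β ∧ b = α := by
  classical
  have ha := congrArg (coeff a) h
  have hb := congrArg (coeff b) h
  simp only [pureBinomial, coeff_sub, coeff_monomial, if_pos, if_neg hab, if_neg hab.symm] at ha hb
  by_cases h1 : α = a
  · subst h1
    rw [if_neg hab] at hb
    by_cases h2 : β = b
    · exact Or.inl ⟨rfl, h2.symm⟩
    · rw [if_neg h2] at hb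
      simp at hb
  · rw [if_neg h1] at ha
    by_cases h2 : β = a
    · subst h2
      by_cases h3 : α = b
      · exact Or.inr ⟨rfl, h3.symm⟩
      · rw [if_neg h3, if_neg hab] at hb
        simp at hb
    · rw [if_neg h2] at ha
      simp at ha

namespace SimpleGraph

variable {V : Type*}

/-- The indicator vectors modulo `2` of the chordless cycles. -/
def chordlessVectors (G : SimpleGraph V) : Set (G.edgeSet → ZMod 2) :=
  {x | ∃ (u : V) (w : G.Walk u u), w.IsCycle ∧ w.IsChordless ∧ x = w.edgeIndicator}

end SimpleGraph

namespace GraphOrientation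

open MvPolynomial SimpleGraph

variable {V : Type*} {G : SimpleGraph V}

/-- A bipartite graph has an orientation for which each vertex is a source or a sink. -/
lemma exists_orientation_of_isBipartite (hG : G.IsBipartite) :
    ∃ (O : GraphOrientation G) (ε : V → ℤ), (∀ v, IsUnit (ε v)) ∧
      ∀ (e : G.edgeSet) (v : V), v ∈ (e : Sym2 V) → O.incidenceVector e v = ε v := by
  classical
  obtain ⟨c⟩ := hG
  have h : ∀ e : G.edgeSet, ∃ a b : V, s(a, b) = (e : Sym2 V) ∧ c a = 0 ∧ c b = 1 := by
    rintro ⟨e, he⟩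
    induction e with
    | h a b =>
      have hne : c a ≠ c b := c.valid he
      by_cases ha : c a = 0
      · exact ⟨a, b, rfl, ha, by omega⟩
      · exact ⟨b, a, Sym2.eq_swap, by omega, by omega⟩
  choose t h hmk ht hh using h
  refine ⟨⟨t, h, hmk⟩, fun v => if c v = 0 then -1 else 1, fun v => ?_, fun e v hv => ?_⟩
  · beta_reduce
    split_ifs <;> simp
  · have hne : t e ≠ h e := tail_ne_head ⟨t, h, hmk⟩ e
    rw [incidenceVector_apply]
    rcases (mem_edge_iff ⟨t, h, hmk⟩ e v).1 hv with rfl | rfl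
    · simp [ht, hne.symm]
    · simp [hh, hne]

variable {O : GraphOrientation G} [Fintype G.edgeSet] {ε : V → ℤ}

/-- All edges at `v` contribute with the same sign, so nothing can cancel. -/
lemma eq_zero_of_boundary_eq_zero (hε : ∀ v, IsUnit (ε v))
    (hO : ∀ (e : G.edgeSet) (v : V), v ∈ (e : Sym2 V) → O.incidenceVector e v = ε v)
    {γ : G.edgeSet →₀ ℕ} {v : V} (h : O.expBoundary γ v = 0) {e : G.edgeSet}
    (hv : v ∈ (e : Sym2 V)) : γ e = 0 := by
  rw [expBoundary_apply, boundary_apply] at h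
  have hsq : ε v * ε v = 1 := by rcases Int.isUnit_iff.1 (hε v) with h | h <;> simp [h]
  have h1 : ∑ e, (γ e : ℤ) * (O.incidenceVector e v * ε v) = 0 := by
    simp only [← mul_assoc, ← Finset.sum_mul]
    simpa using Or.inl h
  rw [Finset.sum_eq_zero_iff_of_nonneg] at h1
  · have := h1 e (Finset.mem_univ _)
    rw [hO e v hv, hsq] at this
    simpa using this
  · intro e _
    by_cases hv : v ∈ (e : Sym2 V)
    · rw [hO e v hv, hsq]; simp
    · rw [O.incidenceVector_of_notMem hv]; simp

/-- The two exponents of the binomial of a chordless cycle are the only ones with their boundary. -/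
lemma eq_or_eq_of_expBoundary_eq (hε : ∀ v, IsUnit (ε v))
    (hO : ∀ (e : G.edgeSet) (v : V), v ∈ (e : Sym2 V) → O.incidenceVector e v = ε v)
    {u : V} {w : G.Walk u u} (hw : w.IsCycle) (hc : w.IsChordless) {γ : G.edgeSet →₀ ℕ}
    (h : O.expBoundary γ = O.expBoundary (posExp (O.walkVec w))) :
    γ = posExp (O.walkVec w) ∨ γ = posExp (-O.walkVec w) := by
  classical
  set χ := O.walkVec w with hχ
  set α := posExp χ with hα
  set β := posExp (-χ) with hβ
  have hαβ : ∀ e, (α e : ℤ) - β e = χ e := fun e => congrFun (expDiff_posExp χ) e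
  have hχs : ∀ e : G.edgeSet, χ e ≠ 0 → (e : Sym2 V) ∈ w.edges := fun e he => by
    by_contra hcon
    exact he (O.walkVec_of_notMem w hcon)
  have hχu : ∀ e : G.edgeSet, (e : Sym2 V) ∈ w.edges → χ e = 1 ∨ χ e = -1 := fun e he =>
    Int.isUnit_iff.1 (O.walkVec_isUnit w hw.isTrail he)
  have hbd : O.expBoundary α = O.expBoundary β := by
    rw [expBoundary_eq_iff, expDiff_posExp]
    exact O.walkVec_mem_flows w
  obtain ⟨e₀, he₀⟩ : ∃ e : G.edgeSet, χ e ≠ 0 := by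
    obtain ⟨a, ha, hs⟩ : ∃ (a : V) (ha : G.Adj u a), s(u, a) ∈ w.edges := by
      cases w with
      | nil => exact absurd hw (by simp)
      | cons ha p => exact ⟨_, ha, by simp⟩
    refine ⟨⟨s(u, a), ha⟩, ?_⟩
    rcases hχu ⟨s(u, a), ha⟩ hs with h1 | h1 <;> simp [h1]
  -- Only the exponent zero has boundary zero. Hence neither monomial of the cycle is `1`, and `χ`
  -- takes both values `1` and `-1`.
  have hzero : ∀ δ δ' : G.edgeSet →₀ ℕ, O.expBoundary δ = O.expBoundary δ' → δ = 0 → δ' = 0 := by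
    rintro δ δ' hδ rfl
    ext e
    refine eq_zero_of_boundary_eq_zero hε hO (v := O.head e) ?_ (O.head_mem e)
    rw [← hδ]; simp
  have hpos : ∃ e, χ e = 1 := by
    by_contra hcon
    push Not at hcon
    have hα0 : α = 0 := by
      ext e
      have h1 : χ e ≤ 0 := by
        by_cases h0 : χ e = 0
        · exact h0.le
        · rcases hχu e (hχs e h0) with h1 | h1
          · exact absurd h1 (hcon e)
          · omega
      simpa [hα] using h1
    have hβ0 := hzero _ _ hbd hα0
    have := hαβ e₀
    rw [hα0, hβ0] at this
    exact he₀ (by simpa using this.symm)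
  have hneg : ∃ e, χ e = -1 := by
    by_contra hcon
    push Not at hcon
    have hβ0 : β = 0 := by
      ext e
      have h1 : 0 ≤ χ e := by
        by_cases h0 : χ e = 0
        · exact h0.ge
        · rcases hχu e (hχs e h0) with h1 | h1
          · omega
          · exact absurd h1 (hcon e)
      simpa [hβ] using h1
    have hα0 := hzero _ _ hbd.symm hβ0
    have := hαβ e₀
    rw [hα0, hβ0] at this
    exact he₀ (by simpa using this.symm)
  have hαs : ∀ e : G.edgeSet, α e ≠ 0 → (e : Sym2 V) ∈ w.edges := fun e he =>
    hχs e fun h0 => he (by simp [hα, h0])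
  have hflow : expDiff γ α ∈ O.flows ℤ := O.expBoundary_eq_iff.1 h
  -- Without cancellation, `γ` uses only edges with both ends on the cycle. These belong to the
  -- cycle because it is chordless, so `γ - α` is a multiple of `χ`.
  have hγs : ∀ e : G.edgeSet, γ e ≠ 0 → ∀ v ∈ (e : Sym2 V), v ∈ w.support := by
    intro e he v hv
    by_contra hvs
    refine he (eq_zero_of_boundary_eq_zero hε hO (v := v) ?_ hv)
    rw [h, expBoundary_apply]
    refine O.boundary_eq_zero_of_notMem fun e' he' hve => hvs ?_
    exact w.mem_support_of_mem_edges (hαs e' (by simpa using he')) hve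
  obtain ⟨c, hcχ⟩ := O.eq_smul_walkVec hflow hw (fun e he => by
    by_cases hαe : α e = 0
    · have hγe : γ e ≠ 0 := fun h0 => he (by simp [expDiff, hαe, h0])
      have h1 := hγs e hγe
      have hadj : G.Adj (O.tail e) (O.head e) := by
        have := e.2
        rwa [← O.mk_eq e] at this
      rw [← O.mk_eq e]
      exact hc.mem_edges (h1 _ (O.tail_mem e)) (h1 _ (O.head_mem e)) hadj
    · exact hαs e hαe)
  have hγ : ∀ e, (γ e : ℤ) = α e + c * χ e := by
    intro e
    have := congrFun hcχ e
    simp only [expDiff, Pi.smul_apply, smul_eq_mul, Int.cast_id] at this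
    linarith
  -- Nonnegativity of `γ` where `χ` is `1` gives `c ≥ -1`, and where `χ` is `-1` it gives `c ≤ 0`.
  obtain ⟨e₁, he₁⟩ := hpos
  obtain ⟨e₂, he₂⟩ := hneg
  have hc1 : -1 ≤ c := by
    have h1 := hγ e₁
    have h2 : α e₁ = 1 := by simp [hα, he₁]
    rw [he₁, h2] at h1
    push_cast at h1
    omega
  have hc2 : c ≤ 0 := by
    have h1 := hγ e₂
    have h2 : α e₂ = 0 := by simp [hα, he₂]
    rw [he₂, h2] at h1
    push_cast at h1
    omega
  rcases (show c = 0 ∨ c = -1 by omega) with rfl | rfl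
  · left
    ext e
    have := hγ e
    zify
    linarith
  · right
    ext e
    have := hγ e
    have h2 := hαβ e
    zify
    linarith

/-- If the toric ideal of a bipartite graph, all of whose vertices are sources or sinks, is a binomial
complete intersection, then the chordless cycles are independent. -/
lemma linearIndepOn_chordlessVectors [Finite V] {k : Type*} [Field k] (hε : ∀ v, IsUnit (ε v))
    (hO : ∀ (e : G.edgeSet) (v : V), v ∈ (e : Sym2 V) → O.incidenceVector e v = ε v)
    (hCI : IsBinomialCompleteIntersection k O) :
    LinearIndepOn (ZMod 2) id G.chordlessVectors := by
  classical
  obtain ⟨S, hcard, hS, hspan⟩ := hCI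
  have hS' : ∀ f : S, ∃ a b : G.edgeSet →₀ ℕ, a ≠ b ∧ f.1 = pureBinomial k a b := fun f => hS f.1 f.2
  choose a b hab hfab using hS'
  have hfl := O.span_modTwo_eq_flows (k := k) a b (by
    simp only [← hfab]
    rw [← hspan]
    simp)
  -- The generators span the flows modulo `2` and are as many as the dimension, so they give a
  -- basis.
  have hind : LinearIndependent (ZMod 2) fun f : S => modTwo (expDiff (a f) (b f)) := by
    rw [linearIndependent_iff_card_eq_finrank_span, Set.finrank, hfl]
    have := O.finrank_flows (K := ZMod 2)
    rw [Fintype.card_coe]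
    omega
  refine hind.linearIndepOn_id.mono ?_
  rintro _ ⟨u, w, hw, hc, rfl⟩
  set χ := O.walkVec w with hχ
  have hne : posExp χ ≠ posExp (-χ) := by
    intro h0
    have h1 := expDiff_posExp χ
    rw [h0, expDiff_eq_zero.2 rfl] at h1
    cases w with
    | nil => exact absurd hw (by simp)
    | @cons _ c' _ h p =>
      have := O.walkVec_isUnit _ hw.isTrail (e := ⟨s(u, c'), h⟩) (by simp)
      rw [← hχ, ← h1] at this
      simp at this
  have hmem : pureBinomial k (posExp χ) (posExp (-χ)) ∈
      Ideal.span (S : Set (MvPolynomial G.edgeSet k)) := by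
    rw [hspan, pureBinomial_mem_toricIdeal, expBoundary_eq_iff, expDiff_posExp]
    exact O.walkVec_mem_flows w
  -- Some generator rewrites the first monomial of the cycle. The result has the same boundary, so
  -- it can only be the second monomial.
  obtain ⟨x, y, hxy, hle, hxyS⟩ := exists_rewrite_of_mem_span (fun f hf => hS f hf) hne hmem
  obtain ⟨γ, hγ⟩ := exists_add_of_le hle
  have hbd : O.expBoundary x = O.expBoundary y := by
    rcases hxyS with h | h
    · rw [← O.pureBinomial_mem_toricIdeal (k := k), ← hspan]
      exact Ideal.subset_span h
    · symm
      rw [← O.pureBinomial_mem_toricIdeal (k := k), ← hspan]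
      exact Ideal.subset_span h
  have hfib : O.expBoundary (y + γ) = O.expBoundary (posExp χ) := by
    rw [hγ, map_add, map_add, hbd]
  have hyγ : y + γ = posExp (-χ) := by
    refine (eq_or_eq_of_expBoundary_eq hε hO hw hc hfib).resolve_left fun h => hxy ?_
    rw [← hχ, hγ] at h
    exact (add_right_cancel h).symm
  -- The two monomials of the cycle have disjoint supports and so no common factor: the generator is
  -- the binomial of the cycle itself, up to sign.
  have hγ0 : γ = 0 := by
    ext e
    have h1 := DFunLike.congr_fun hγ e
    have h2 := DFunLike.congr_fun hyγ e
    simp only [posExp_apply, Finsupp.add_apply, Pi.neg_apply] at h1 h2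
    simp only [Finsupp.coe_zero, Pi.zero_apply]
    omega
  rw [hγ0, add_zero] at hγ hyγ
  subst hγ hyγ
  have hvec : modTwo χ = w.edgeIndicator := O.walkVec_cast_eq_edgeIndicator w hw.isTrail
  have hvec' : modTwo (-χ) = w.edgeIndicator := by
    rw [← hvec]
    ext e
    simp [modTwo_apply, ZMod.neg_eq_self_mod_two]
  have hfin : ∀ f : S, (f.1 = pureBinomial k (posExp χ) (posExp (-χ)) ∨
      f.1 = pureBinomial k (posExp (-χ)) (posExp χ)) →
      modTwo (expDiff (a f) (b f)) = w.edgeIndicator := by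
    have hd : expDiff (posExp (-χ)) (posExp χ) = -χ := by
      have := expDiff_posExp (-χ)
      rwa [neg_neg] at this
    intro f hf
    rw [hfab f] at hf
    rcases hf with hf | hf
    · rcases eq_and_eq_of_pureBinomial_eq (hab f) hf with ⟨h1, h2⟩ | ⟨h1, h2⟩
      · rw [h1, h2, expDiff_posExp, hvec]
      · rw [h1, h2, hd, hvec']
    · rcases eq_and_eq_of_pureBinomial_eq (hab f) hf with ⟨h1, h2⟩ | ⟨h1, h2⟩
      · rw [h1, h2, hd, hvec']
      · rw [h1, h2, expDiff_posExp, hvec]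
  rcases hxyS with h | h
  · exact ⟨⟨_, h⟩, hfin ⟨_, h⟩ (Or.inl rfl)⟩
  · exact ⟨⟨_, h⟩, hfin ⟨_, h⟩ (Or.inr rfl)⟩

end GraphOrientation

/-! ### Chordless paths and shortest ears -/

namespace SimpleGraph

variable {V : Type*} {G : SimpleGraph V}

namespace Walk

/-- A walk that cannot be shortened within its support is chordless. -/
lemma isChordless_of_minimal {x y : V} (p : G.Walk x y)
    (hmin : ∀ q : G.Walk x y, (∀ v ∈ q.support, v ∈ p.support) → p.length ≤ q.length) :
    p.IsChordless := by
  -- A chord would be a shortcut between two vertices of the walk.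
  have key : ∀ i j, i < j → j ≤ p.length → G.Adj (p.getVert i) (p.getVert j) → j = i + 1 := by
    intro i j hij hj hadj
    have := hmin ((p.take i).append (.cons hadj (p.drop j))) ?_
    · rw [length_append, length_cons, take_length, drop_length] at this
      omega
    · intro v hv
      rw [mem_support_append_iff, support_cons, List.mem_cons] at hv
      rcases hv with hv | rfl | hv
      · exact (p.isSubwalk_take i).support_subset hv
      · exact p.getVert_mem_support i
      · exact (p.isSubwalk_drop j).support_subset hv
  rw [isChordless_iff_forall_mem_edges]
  intro a b ha hb hadj
  rw [mem_support_iff_exists_getVert] at ha hb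
  obtain ⟨i, rfl, hi⟩ := ha
  obtain ⟨j, rfl, hj⟩ := hb
  rcases lt_trichotomy i j with h | h | h
  · have := key i j h hj hadj
    subst this
    rw [← adj_toSubgraph_iff_mem_edges]
    exact p.toSubgraph_adj_getVert (by omega)
  · subst h
    exact absurd hadj (G.loopless.irrefl _)
  · have := key j i h hi hadj.symm
    subst this
    rw [Sym2.eq_swap, ← adj_toSubgraph_iff_mem_edges]
    exact p.toSubgraph_adj_getVert (by omega)

/-- Inside of a set of vertices `s`, a shortest walk from a vertex to a set `T` is a chordless path
that meets `T` only in its last vertex. -/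
lemma exists_chordless_isPath {s T : Set V} {x : V}
    (h : ∃ y ∈ T, ∃ p : G.Walk x y, ∀ v ∈ p.support, v ∈ s) :
    ∃ y ∈ T, ∃ p : G.Walk x y, p.IsPath ∧ p.IsChordless ∧ (∀ v ∈ p.support, v ∈ s) ∧
      ∀ v ∈ p.support, v ∈ T → v = y := by
  classical
  have hex : ∃ n, ∃ y ∈ T, ∃ p : G.Walk x y, (∀ v ∈ p.support, v ∈ s) ∧ p.length = n := by
    obtain ⟨y, hy, p, hp⟩ := h
    exact ⟨_, y, hy, p, hp, rfl⟩
  obtain ⟨y, hy, p, hp, hlen⟩ := Nat.find_spec hex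
  have hmin : ∀ z ∈ T, ∀ q : G.Walk x z, (∀ v ∈ q.support, v ∈ s) → p.length ≤ q.length := by
    intro z hz q hq
    rw [hlen]
    exact Nat.find_min' hex ⟨z, hz, q, hq, rfl⟩
  have hbs : ∀ v ∈ p.bypass.support, v ∈ s := fun v hv => hp v (p.support_bypass_subset_support hv)
  have hbl : p.bypass.length = p.length := le_antisymm p.length_bypass_le_length (hmin y hy _ hbs)
  refine ⟨y, hy, p.bypass, p.bypass_isPath, ?_, hbs, fun v hv hvT => ?_⟩
  · refine p.bypass.isChordless_of_minimal fun q hq => ?_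
    rw [hbl]
    exact hmin y hy q fun v hv => hbs v (hq v hv)
  · by_contra hne
    have h1 := length_takeUntil_lt_length hv hne
    have h2 := hmin v hvT (p.bypass.takeUntil v hv)
      fun z hz => hbs z (p.bypass.support_takeUntil_subset_support hv hz)
    omega

/-- The initial part of a walk into `W`. -/
lemma exists_first_hit {W : Set V} {x z : V} (p : G.Walk x z) (hx : x ∉ W) (hz : z ∈ W) :
    ∃ (y v : V) (D : G.Walk x y), (∀ d ∈ D.support, d ∉ W ∧ d ∈ p.support) ∧ G.Adj y v ∧ v ∈ W ∧
      v ∈ p.support := by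
  induction p with
  | nil => exact absurd hz hx
  | @cons x a z h q ih =>
    by_cases ha : a ∈ W
    · exact ⟨x, a, .nil, by simp [hx], h, ha, by simp⟩
    · obtain ⟨y, v, D, hD, hyv, hv, hvq⟩ := ih ha hz
      refine ⟨y, v, .cons h D, fun d hd => ?_, hyv, hv, by simp [hvq]⟩
      rw [support_cons, List.mem_cons] at hd
      rcases hd with rfl | hd
      · exact ⟨hx, by simp⟩
      · exact ⟨(hD d hd).1, by simp [(hD d hd).2]⟩

/-- Two paths without common vertices that are joined by two edges form a cycle. -/
lemma isCycle_cons_append_cons {n m d d' : V} (h : G.Adj n d) {P : G.Walk d d'} (h' : G.Adj d' m)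
    {Q : G.Walk m n} (hP : P.IsPath) (hQ : Q.IsPath) (hdisj : ∀ v ∈ P.support, v ∉ Q.support)
    (hnm : n ≠ m) : (Walk.cons h (P.append (.cons h' Q))).IsCycle := by
  rw [cons_isCycle_iff]
  constructor
  · rw [isPath_def, support_append, support_cons, List.tail_cons, List.nodup_append']
    exact ⟨hP.support_nodup, hQ.support_nodup, fun v hv hv' => hdisj v hv hv'⟩
  · rw [edges_append, edges_cons, List.mem_append, List.mem_cons]
    have hn : n ∉ P.support := fun hn => hdisj n hn Q.end_mem_support
    rintro (h1 | h1 | h1)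
    · exact hn (P.fst_mem_support_of_mem_edges h1)
    · rw [Sym2.eq_iff] at h1
      rcases h1 with ⟨h2, -⟩ | ⟨h2, -⟩
      · exact hn (h2 ▸ P.end_mem_support)
      · exact hnm h2
    · exact hdisj d P.start_mem_support (Q.snd_mem_support_of_mem_edges h1)

/-- A walk that leaves `W` at `u`, runs outside of `W`, and returns to `W` at another vertex `v`. Only
its part outside of `W` is recorded. -/
structure IsEar (W : Set V) (u v : V) {x y : V} (D : G.Walk x y) : Prop where
  left_mem : u ∈ W
  right_mem : v ∈ W
  ne : u ≠ v
  left_adj : G.Adj u x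
  right_adj : G.Adj v y
  notMem : ∀ d ∈ D.support, d ∉ W

/-- A shortest ear. -/
structure IsMinimalEar (W : Set V) (u v : V) {x y : V} (D : G.Walk x y) : Prop
    extends D.IsEar W u v where
  minimal : ∀ (u' v' x' y' : V) (D' : G.Walk x' y'), D'.IsEar W u' v' → D.length ≤ D'.length
  isPath : D.IsPath

lemma IsEar.exists_isMinimalEar {W : Set V} {u v x y : V} {D : G.Walk x y} (h : D.IsEar W u v) :
    ∃ (u v x y : V) (D : G.Walk x y), D.IsMinimalEar W u v := by
  classical
  have hex : ∃ n, ∃ (u v x y : V) (D : G.Walk x y), D.IsEar W u v ∧ D.length = n :=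
    ⟨_, u, v, x, y, D, h, rfl⟩
  obtain ⟨u, v, x, y, D, hD, hlen⟩ := Nat.find_spec hex
  refine ⟨u, v, x, y, D.bypass, ⟨hD.left_mem, hD.right_mem, hD.ne, hD.left_adj, hD.right_adj,
    fun d hd => hD.notMem d (D.support_bypass_subset_support hd)⟩, fun u' v' x' y' D' hD' => ?_,
    D.bypass_isPath⟩
  refine D.length_bypass_le_length.trans ?_
  rw [hlen]
  exact Nat.find_min' hex ⟨u', v', x', y', D', hD', rfl⟩

namespace IsMinimalEar

variable {W : Set V} {u v x y : V} {D : G.Walk x y}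

lemma isChordless (h : D.IsMinimalEar W u v) : D.IsChordless :=
  D.isChordless_of_minimal fun q hq => h.minimal u v x y q ⟨h.left_mem, h.right_mem, h.ne,
    h.left_adj, h.right_adj, fun d hd => h.notMem d (hq d hd)⟩

/-- Otherwise the part of the ear before or after `d` would be a shorter ear ending at `w`. For `x =
y` the ear is a single vertex, which may have any number of neighbours in `W`. -/
lemma adj_cases (h : D.IsMinimalEar W u v) {w d : V} (hw : w ∈ W) (hd : d ∈ D.support)
    (hadj : G.Adj w d) : x = y ∨ w = u ∧ d = x ∨ w = v ∧ d = y := by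
  classical
  have h1 : w ≠ u → d = y := by
    intro hne
    by_contra hdy
    have hlt := length_takeUntil_lt_length hd hdy
    have := h.minimal u w x d (D.takeUntil d hd) ⟨h.left_mem, hw, hne.symm, h.left_adj, hadj,
      fun z hz => h.notMem z (D.support_takeUntil_subset_support hd hz)⟩
    omega
  have h2 : w ≠ v → d = x := by
    intro hne
    by_contra hdx
    have hlt := length_dropUntil_lt_length hd hdx
    have := h.minimal w v d y (D.dropUntil d hd) ⟨hw, h.right_mem, hne, hadj, h.right_adj,
      fun z hz => h.notMem z (D.support_dropUntil_subset_support hd hz)⟩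
    omega
  by_cases hu : w = u
  · exact Or.inr (Or.inl ⟨hu, h2 (hu ▸ h.ne)⟩)
  · by_cases hv : w = v
    · exact Or.inr (Or.inr ⟨hv, h1 hu⟩)
    · exact Or.inl ((h2 hv).symm.trans (h1 hu))

lemma support_of_eq (h : D.IsMinimalEar W u v) (hxy : x = y) {d : V} (hd : d ∈ D.support) :
    d = x := by
  subst hxy
  have hnil := isPath_iff_nil.1 h.isPath
  rw [nil_iff_support_eq.1 hnil] at hd
  simpa using hd

/-- Each vertex of `W` has at most one neighbour in a shortest ear. -/
lemma adj_unique (h : D.IsMinimalEar W u v) {w d d' : V} (hw : w ∈ W) (hd : d ∈ D.support)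
    (hd' : d' ∈ D.support) (hadj : G.Adj w d) (hadj' : G.Adj w d') : d = d' := by
  by_cases hxy : x = y
  · rw [h.support_of_eq hxy hd, h.support_of_eq hxy hd']
  · have hne := h.ne
    rcases (h.adj_cases hw hd hadj).resolve_left hxy with ⟨rfl, rfl⟩ | ⟨rfl, rfl⟩ <;>
      rcases (h.adj_cases hw hd' hadj').resolve_left hxy with ⟨h1, rfl⟩ | ⟨h1, rfl⟩
    · rfl
    · exact absurd h1 hne
    · exact absurd h1.symm hne
    · rfl

/-- Any two vertices of `W` with neighbours in a shortest ear are joined through the whole ear. -/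
lemma exists_walk (h : D.IsMinimalEar W u v) {n m d d' : V} (hn : n ∈ W) (hm : m ∈ W) (hnm : n ≠ m)
    (hd : d ∈ D.support) (hd' : d' ∈ D.support) (hnd : G.Adj n d) (hmd' : G.Adj m d') :
    ∃ P : G.Walk d d', P.IsPath ∧ P.IsChordless ∧ ∀ z, z ∈ P.support ↔ z ∈ D.support := by
  -- A one-vertex ear gives the trivial walk. Otherwise `n` and `m` are `u` and `v` in some order,
  -- and the walk is the ear or its reverse.
  by_cases hxy : x = y
  · obtain rfl := h.support_of_eq hxy hd
    obtain rfl := h.support_of_eq hxy hd'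
    refine ⟨.nil, by simp, ?_, fun z => ?_⟩
    · rw [isChordless_iff_forall_mem_edges]
      intro a b ha hb hab
      simp only [support_nil, List.mem_singleton] at ha hb
      rw [ha, hb] at hab
      exact absurd hab (G.loopless.irrefl _)
    · simp only [support_nil, List.mem_singleton]
      exact ⟨fun h => h ▸ D.start_mem_support, fun hz => h.support_of_eq hxy hz⟩
  · rcases (h.adj_cases hn hd hnd).resolve_left hxy with ⟨rfl, rfl⟩ | ⟨rfl, rfl⟩ <;>
      rcases (h.adj_cases hm hd' hmd').resolve_left hxy with ⟨h1, rfl⟩ | ⟨h1, rfl⟩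
    · exact absurd h1.symm hnm
    · exact ⟨D, h.isPath, h.isChordless, fun z => Iff.rfl⟩
    · refine ⟨D.reverse, h.isPath.reverse, ?_, fun z => by simp⟩
      rw [isChordless_iff_forall_mem_edges]
      intro a b ha hb hab
      rw [support_reverse, List.mem_reverse] at ha hb
      rw [edges_reverse, List.mem_reverse]
      exact h.isChordless.mem_edges ha hb hab
    · exact absurd h1.symm hnm

end IsMinimalEar

end Walk

namespace Subgraph

/-- A walk from outside enters `W` at some `v`, coming from a vertex `y`. Since `v` is no cut
vertex, another walk from `y` reaches `W` while avoiding `v`. Its part outside of `W` is the ear. -/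
lemma IsNonseparable.exists_isEar {B : G.Subgraph} (hB : B.IsNonseparable) {W : Set V}
    (hWB : W ⊆ B.verts) (hne : W ≠ B.verts) {a b : V} (hab : a ≠ b) (ha : a ∈ W) (hb : b ∈ W) :
    ∃ (u v x y : V) (D : G.Walk x y), D.IsEar W u v := by
  rw [isNonseparable_iff] at hB
  obtain ⟨w₀, hw₀, hw₀W⟩ := Set.exists_of_ssubset (hWB.ssubset_of_ne hne)
  obtain ⟨p, hp⟩ := hB.2.1 w₀ hw₀ a (hWB ha)
  obtain ⟨y, v, D, hD, hyv, hv, -⟩ := p.exists_first_hit hw₀W ha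
  have hyB : y ∈ B.verts := hp.1 (p.mem_verts_toSubgraph.2 (hD y D.end_mem_support).2)
  have hyW := (hD y D.end_mem_support).1
  obtain ⟨c, hc, hcv⟩ : ∃ c ∈ W, c ≠ v := by
    by_cases hav : a = v
    · exact ⟨b, hb, fun h => hab (hav.trans h.symm)⟩
    · exact ⟨a, ha, hav⟩
  obtain ⟨q, -, hvq⟩ := hB.2.2 v (hWB hv) y hyB c (hWB hc) (fun h => hyW (h ▸ hv)) hcv
  obtain ⟨y', v', D', hD', hyv', hv', hvq'⟩ := q.exists_first_hit hyW hc
  exact ⟨v, v', y, y', D', hv, hv', fun h => hvq (h ▸ hvq'), hyv.symm, hyv'.symm,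
    fun d hd => (hD' d hd).1⟩

end Subgraph

end SimpleGraph

/-! ### Counting entries, and chordless cycles through an ear -/

/-- A matrix modulo `2` with exactly two nonzero entries in each row and at least two in each column
has dependent rows. -/
lemma not_linearIndependent_of_two_entries {ι κ : Type*} [Fintype ι] [Fintype κ] [Nonempty κ]
    (M : ι → κ → ZMod 2) (hrow : ∀ i, (Finset.univ.filter fun n => M i n ≠ 0).card = 2)
    (hcol : ∀ n, ∃ i j, i ≠ j ∧ M i n ≠ 0 ∧ M j n ≠ 0) : ¬ LinearIndependent (ZMod 2) M := by
  classical
  intro hind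
  -- Double counting of the nonzero entries shows that there are at least as many rows as columns.
  have hcard : Fintype.card κ ≤ Fintype.card ι := by
    have h1 : ∑ i, (Finset.univ.filter fun n => M i n ≠ 0).card =
        ∑ n, (Finset.univ.filter fun i => M i n ≠ 0).card := by
      simp only [Finset.card_filter]
      exact Finset.sum_comm
    have h2 : ∀ n, 2 ≤ (Finset.univ.filter fun i => M i n ≠ 0).card := by
      intro n
      obtain ⟨i, j, hij, hi, hj⟩ := hcol n
      exact Finset.one_lt_card.2 ⟨i, by simpa using hi, j, by simpa using hj, hij⟩
    have h3 := Finset.sum_le_sum fun n (_ : n ∈ Finset.univ) => h2 n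
    rw [← h1, Finset.sum_congr rfl fun i _ => hrow i] at h3
    simp only [Finset.sum_const, Finset.card_univ, smul_eq_mul] at h3
    omega
  -- Each row has two entries `1`, so all rows lie in the hyperplane of vectors with coordinate sum
  -- zero, which is too small for them to be independent.
  let s : (κ → ZMod 2) →ₗ[ZMod 2] ZMod 2 := ∑ n, LinearMap.proj n
  have hs : ∀ x, s x = ∑ n, x n := fun x => by simp [s]
  have hle : Submodule.span (ZMod 2) (Set.range M) ≤ LinearMap.ker s := by
    rw [Submodule.span_le]
    rintro _ ⟨i, rfl⟩
    rw [SetLike.mem_coe, LinearMap.mem_ker, hs]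
    have : ∀ x : ZMod 2, x = if x ≠ 0 then 1 else 0 := by decide
    rw [Finset.sum_congr rfl fun n _ => this (M i n), ← Finset.sum_filter, Finset.sum_const, hrow]
    decide
  have hlt : LinearMap.ker s < ⊤ := by
    rw [lt_top_iff_ne_top]
    intro htop
    obtain ⟨n⟩ := ‹Nonempty κ›
    have : Pi.single n (1 : ZMod 2) ∈ LinearMap.ker s := by rw [htop]; trivial
    rw [LinearMap.mem_ker, hs, Finset.sum_pi_single'] at this
    simp at this
  have h1 := Submodule.finrank_mono hle
  have h2 := Submodule.finrank_lt hlt.ne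
  rw [finrank_span_eq_card hind] at h1
  rw [Module.finrank_fintype_fun_eq_card] at h2
  omega

namespace SimpleGraph.Walk

variable {V : Type*} {G : SimpleGraph V}

lemma edgeIndicator_ne_zero {u v : V} {p : G.Walk u v} {e : G.edgeSet} :
    p.edgeIndicator e ≠ 0 ↔ (e : Sym2 V) ∈ p.edges := by
  classical
  rw [edgeIndicator]
  split_ifs with h <;> simp [h]

/-- A closed walk that runs through an ear and returns along a chordless path of `W` that meets the
neighbours of the ear only at its ends is chordless. -/
lemma isChordless_cons_append_cons {W : Set V} {n m d d' : V} (h : G.Adj n d) {P : G.Walk d d'}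
    (h' : G.Adj d' m) {Q : G.Walk m n} (hP : P.IsChordless) (hQ : Q.IsChordless)
    (hPW : ∀ v ∈ P.support, v ∉ W) (hQW : ∀ v ∈ Q.support, v ∈ W)
    (huniq : ∀ v ∈ W, ∀ x ∈ P.support, ∀ y ∈ P.support, G.Adj v x → G.Adj v y → x = y)
    (hQN : ∀ v ∈ Q.support, ∀ x ∈ P.support, G.Adj v x → v = n ∨ v = m) :
    (Walk.cons h (P.append (.cons h' Q))).IsChordless := by
  have hmem : ∀ v, v ∈ (Walk.cons h (P.append (.cons h' Q))).support →
      v ∈ P.support ∨ v ∈ Q.support := by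
    intro v hv
    simp only [support_cons, mem_support_append_iff, List.mem_cons] at hv
    rcases hv with rfl | hv | rfl | hv
    · exact Or.inr Q.end_mem_support
    · exact Or.inl hv
    · exact Or.inl P.end_mem_support
    · exact Or.inr hv
  have hmix : ∀ a b, a ∈ P.support → b ∈ Q.support → G.Adj b a →
      s(b, a) = s(n, d) ∨ s(b, a) = s(d', m) := by
    intro a b ha hb hadj
    rcases hQN b hb a ha hadj with rfl | rfl
    · left
      rw [huniq b (hQW b hb) a ha d P.start_mem_support hadj h]
    · right
      rw [huniq b (hQW b hb) a ha d' P.end_mem_support hadj h'.symm, Sym2.eq_swap]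
  rw [isChordless_iff_forall_mem_edges]
  intro a b ha hb hadj
  simp only [edges_cons, edges_append, List.mem_cons, List.mem_append]
  rcases hmem a ha with ha | ha <;> rcases hmem b hb with hb | hb
  · exact Or.inr (Or.inl (hP.mem_edges ha hb hadj))
  · rw [Sym2.eq_swap (a := a)]
    have := hmix a b ha hb hadj.symm
    tauto
  · have := hmix b a hb ha hadj
    tauto
  · exact Or.inr (Or.inr (Or.inr (hQ.mem_edges ha hb hadj)))

end SimpleGraph.Walk

/-! ### Growing cycle generated subgraphs along ears -/

namespace GraphOrientation

open SimpleGraph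

variable {V : Type*} {G : SimpleGraph V} (O : GraphOrientation G) [Fintype G.edgeSet]

/-- The chordless cycles inside of a subgraph, as vectors modulo `2`. -/
def chordlessVectorsIn (H : G.Subgraph) : Set (G.edgeSet → ZMod 2) :=
  {x | x ∈ G.chordlessVectors ∧ ∀ e : G.edgeSet, x e ≠ 0 → (e : Sym2 V) ∈ H.edgeSet}

/-- An induced nonseparable subgraph whose flows modulo `2` are generated by its chordless cycles. -/
structure IsCycleGenerated (H : G.Subgraph) : Prop where
  isInduced : H.IsInduced
  isNonseparable : H.IsNonseparable
  mem_span : ∀ z ∈ O.flows (ZMod 2), (∀ e : G.edgeSet, z e ≠ 0 → (e : Sym2 V) ∈ H.edgeSet) →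
    z ∈ Submodule.span (ZMod 2) (chordlessVectorsIn H)

variable {O}

lemma isCycleGenerated_toSubgraph {u : V} {w : G.Walk u u} (hw : w.IsCycle) (hc : w.IsChordless) :
    O.IsCycleGenerated w.toSubgraph where
  isInduced := Walk.isInduced_toSubgraph.2 hc
  isNonseparable := Subgraph.isNonseparable_toSubgraph_of_isCycle hw
  mem_span z hz hs := by
    obtain ⟨c, rfl⟩ := O.eq_smul_walkVec hz hw fun e he => w.mem_edges_toSubgraph.1 (hs e he)
    rw [O.walkVec_cast_eq_edgeIndicator w hw.isTrail]
    refine Submodule.smul_mem _ _ (Submodule.subset_span ⟨⟨u, w, hw, hc, rfl⟩, fun e he => ?_⟩)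
    exact w.mem_edges_toSubgraph.2 (Walk.edgeIndicator_ne_zero.1 he)

/-- A flow that vanishes on the edges between a chordless path and the rest of its support vanishes
on the edges of the path. -/
lemma eq_zero_of_mem_support {R : Type*} [CommRing R] {z : G.edgeSet → R} (hz : z ∈ O.flows R)
    {d d' : V} {P : G.Walk d d'} (hP : P.IsPath) (hPc : P.IsChordless)
    (hs : ∀ e : G.edgeSet, z e ≠ 0 → ∀ a ∈ P.support, ∀ b ∉ P.support, (e : Sym2 V) ≠ s(a, b))
    {e : G.edgeSet} {a : V} (ha : a ∈ P.support) (hae : a ∈ (e : Sym2 V)) : z e = 0 := by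
  have hedge : ∀ e : G.edgeSet, z e ≠ 0 → ∀ a ∈ P.support, a ∈ (e : Sym2 V) →
      (e : Sym2 V) ∈ P.edges := by
    intro e he a ha hae
    obtain ⟨b, hb⟩ := Sym2.mem_iff_exists.1 hae
    by_cases hbP : b ∈ P.support
    · rw [hb]
      have hadj : G.Adj a b := by
        have := e.2
        rwa [hb] at this
      exact hPc.mem_edges ha hbP hadj
    · exact absurd hb (hs e he a ha b hbP)
  by_contra he
  refine he (O.eq_zero_of_isPath P hP (fun w _ _ => O.mem_flows.1 hz w) (fun e' he' => ?_) e
    (hedge e he a ha hae))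
  by_cases h1 : (e' : Sym2 V) ∈ P.edges
  · exact Or.inl h1
  · exact Or.inr fun w hw _ hwe => h1 (hedge e' he' w hw hwe)

/-- If the chordless cycles are independent, then a shortest ear of a cycle generated subgraph has two
adjacent neighbours in the subgraph. -/
lemma exists_adj_of_isMinimalEar [Finite V] (hind : LinearIndepOn (ZMod 2) id G.chordlessVectors)
    {H : G.Subgraph} (hH : O.IsCycleGenerated H) {u v x y : V} {D : G.Walk x y}
    (hD : D.IsMinimalEar H.verts u v) :
    ∃ n ∈ H.verts, ∃ m ∈ H.verts, ∃ d ∈ D.support, ∃ d' ∈ D.support,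
      G.Adj n d ∧ G.Adj m d' ∧ G.Adj n m := by
  classical
  by_contra hcon
  push Not at hcon
  cases nonempty_fintype V
  let N : Set V := {n | n ∈ H.verts ∧ ∃ d ∈ D.support, G.Adj n d}
  have hNδ : ∀ n : N, ∃ d ∈ D.support, G.Adj n d := fun n => n.2.2
  choose δ hδD hδ using hNδ
  let edge : N → G.edgeSet := fun n => ⟨s(n.1, δ n), hδ n⟩
  have huN : u ∈ N := ⟨hD.left_mem, x, D.start_mem_support, hD.left_adj⟩
  have hvN : v ∈ N := ⟨hD.right_mem, y, D.end_mem_support, hD.right_adj⟩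
  have hNH : ∀ n ∈ N, n ∈ H.verts := fun n hn => hn.1
  -- `N` consists of the attaching vertices, each with its unique edge to the ear. `X` collects the
  -- chordless cycles on the vertices of `H` and the ear that use exactly two attaching edges. The
  -- aim is a dependence among chordless cycles.
  let X : Set (G.edgeSet → ZMod 2) := {z | z ∈ G.chordlessVectors ∧
    (∀ e : G.edgeSet, z e ≠ 0 → ∀ a ∈ (e : Sym2 V), a ∈ H.verts ∨ a ∈ D.support) ∧
    (Finset.univ.filter fun n => z (edge n) ≠ 0).card = 2}
  -- the cycles through the ear
  have hcyc : ∀ (n m : N), n ≠ m → ∀ Q : G.Walk n.1 m.1, Q.IsPath → Q.IsChordless →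
      (∀ a ∈ Q.support, a ∈ H.verts) → (∀ a ∈ Q.support, a ∈ N → a = n.1 ∨ a = m.1) →
      ∃ z ∈ X, z (edge n) ≠ 0 ∧ (∀ e : G.edgeSet, (e : Sym2 V) ∈ Q.edges → z e ≠ 0) ∧
        ∀ e : G.edgeSet, z e ≠ 0 → ∀ a ∈ (e : Sym2 V), a ∈ Q.support ∨ a ∈ D.support := by
    intro n m hnm Q hQp hQc hQH hQN
    have hnm' : n.1 ≠ m.1 := fun h => hnm (Subtype.ext h)
    obtain ⟨P, hPp, hPc, hPs⟩ := hD.exists_walk n.2.1 m.2.1 hnm' (hδD n) (hδD m) (hδ n) (hδ m)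
    have hPW : ∀ a ∈ P.support, a ∉ H.verts := fun a ha => hD.notMem a ((hPs a).1 ha)
    have hRH : ∀ a ∈ Q.reverse.support, a ∈ H.verts := by
      intro a ha
      rw [Walk.support_reverse, List.mem_reverse] at ha
      exact hQH a ha
    have hRc : Q.reverse.IsChordless := by
      rw [Walk.isChordless_iff_forall_mem_edges]
      intro a b ha hb hab
      rw [Walk.support_reverse, List.mem_reverse] at ha hb
      rw [Walk.edges_reverse, List.mem_reverse]
      exact hQc.mem_edges ha hb hab
    have hw := Walk.isCycle_cons_append_cons (hδ n) (hδ m).symm hPp hQp.reverse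
      (fun a ha ha' => hPW a ha (hRH a ha')) hnm'
    have hc := Walk.isChordless_cons_append_cons (W := H.verts) (hδ n) (hδ m).symm hPc hRc hPW hRH
      (fun a ha b hb b' hb' => hD.adj_unique ha ((hPs b).1 hb) ((hPs b').1 hb')) (by
        intro a ha b hb hab
        have haQ : a ∈ Q.support := by
          rwa [Walk.support_reverse, List.mem_reverse] at ha
        exact hQN a haQ ⟨hQH a haQ, b, (hPs b).1 hb, hab⟩)
    set w := Walk.cons (hδ n) (P.append (.cons (hδ m).symm Q.reverse)) with hwdef
    have hedges : ∀ e, e ∈ w.edges ↔ e = s(n.1, δ n) ∨ e ∈ P.edges ∨ e = s(δ m, m.1) ∨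
        e ∈ Q.edges := by
      intro e
      simp [hwdef]
    have hends : ∀ e ∈ w.edges, ∀ a ∈ e, a ∈ Q.support ∨ a ∈ D.support := by
      intro e he a ha
      rcases (hedges e).1 he with rfl | h | rfl | h
      · rcases Sym2.mem_iff.1 ha with rfl | rfl
        · exact Or.inl Q.start_mem_support
        · exact Or.inr (hδD n)
      · exact Or.inr ((hPs a).1 (P.mem_support_of_mem_edges h ha))
      · rcases Sym2.mem_iff.1 ha with rfl | rfl
        · exact Or.inr (hδD m)
        · exact Or.inl Q.end_mem_support
      · exact Or.inl (Q.mem_support_of_mem_edges h ha)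
    have hn0 : ∀ n' : N, w.edgeIndicator (edge n') ≠ 0 ↔ n' = n ∨ n' = m := by
      intro n'
      rw [Walk.edgeIndicator_ne_zero, hedges]
      constructor
      · rintro (h | h | h | h)
        · rw [Sym2.eq_iff] at h
          rcases h with ⟨h1, -⟩ | ⟨h1, -⟩
          · exact Or.inl (Subtype.ext h1)
          · exact absurd (hNH _ n'.2) (h1 ▸ hD.notMem _ (hδD n))
        · exact absurd (hNH _ n'.2) (hPW _ (P.fst_mem_support_of_mem_edges h))
        · rw [Sym2.eq_iff] at h
          rcases h with ⟨h1, -⟩ | ⟨h1, -⟩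
          · exact absurd (hNH _ n'.2) (h1 ▸ hD.notMem _ (hδD m))
          · exact Or.inr (Subtype.ext h1)
        · exact absurd (hQH _ (Q.snd_mem_support_of_mem_edges h)) (hD.notMem _ (hδD n'))
      · rintro (rfl | rfl)
        · exact Or.inl rfl
        · exact Or.inr (Or.inr (Or.inl Sym2.eq_swap))
    refine ⟨w.edgeIndicator, ⟨⟨n.1, w, hw, hc, rfl⟩, fun e he a ha => ?_, ?_⟩,
      (hn0 n).2 (Or.inl rfl), fun e he => ?_, fun e he => ?_⟩
    · exact (hends e (Walk.edgeIndicator_ne_zero.1 he) a ha).imp_left (hQH a)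
    · have : (Finset.univ.filter fun n' => w.edgeIndicator (edge n') ≠ 0) = {n, m} := by
        ext n'
        simp only [Finset.mem_filter, Finset.mem_univ, true_and, hn0, Finset.mem_insert,
          Finset.mem_singleton]
      rw [this, Finset.card_pair hnm]
    · rw [Walk.edgeIndicator_ne_zero, hedges]
      tauto
    · exact hends e (Walk.edgeIndicator_ne_zero.1 he)
  have hnsep := Subgraph.isNonseparable_iff.1 hH.isNonseparable
  -- Close the ear by a shortest path of `H` from `n` to another attaching vertex. Its second vertex
  -- `a` is not attaching by `hcon` and is no cut vertex, so a second path avoids `a`. The two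
  -- cycles differ at the edge from `n` to `a`.
  have htwo : ∀ n : N, ∃ z z' : X, z ≠ z' ∧ z.1 (edge n) ≠ 0 ∧ z'.1 (edge n) ≠ 0 := by
    intro n
    obtain ⟨m, hmN, hmn⟩ : ∃ m ∈ N, m ≠ n.1 := by
      by_cases h : u = n.1
      · exact ⟨v, hvN, fun h' => hD.ne (h.trans h'.symm)⟩
      · exact ⟨u, huN, h⟩
    obtain ⟨p, hp⟩ := hnsep.2.1 n.1 n.2.1 m hmN.1
    obtain ⟨m₁, hm₁, Q₁, hQ₁p, hQ₁c, hQ₁H, hQ₁N⟩ := Walk.exists_chordless_isPath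
      (s := H.verts) (T := N \ {n.1}) ⟨m, ⟨hmN, hmn⟩, p, fun a ha =>
        hp.1 (p.mem_verts_toSubgraph.2 ha)⟩
    obtain ⟨a, hna, haQ⟩ : ∃ a, ∃ h : G.Adj n.1 a, s(n.1, a) ∈ Q₁.edges := by
      cases Q₁ with
      | nil => exact absurd rfl hm₁.2
      | cons h q => exact ⟨_, h, by simp⟩
    have haH : a ∈ H.verts := hQ₁H a (Q₁.snd_mem_support_of_mem_edges haQ)
    have haN : a ∉ N := by
      rintro ⟨_, d', hd', had'⟩
      exact hcon n.1 n.2.1 a haH (δ n) (hδD n) d' hd' (hδ n) had' hna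
    obtain ⟨q, hq, haq⟩ := hnsep.2.2 a haH n.1 n.2.1 m hmN.1 (fun h => haN (h ▸ n.2))
      (fun h => haN (h ▸ hmN))
    obtain ⟨m₂, hm₂, Q₂, hQ₂p, hQ₂c, hQ₂H, hQ₂N⟩ := Walk.exists_chordless_isPath
      (s := H.verts \ {a}) (T := N \ {n.1}) ⟨m, ⟨hmN, hmn⟩, q, fun b hb =>
        ⟨hq.1 (q.mem_verts_toSubgraph.2 hb), fun h => haq (h ▸ hb)⟩⟩
    obtain ⟨z₁, hz₁, hz₁n, hz₁Q, -⟩ := hcyc n ⟨m₁, hm₁.1⟩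
      (fun h => hm₁.2 (congrArg Subtype.val h).symm) Q₁ hQ₁p hQ₁c hQ₁H (fun b hb hbN => by
        by_cases h : b = n.1
        · exact Or.inl h
        · exact Or.inr (hQ₁N b hb ⟨hbN, h⟩))
    obtain ⟨z₂, hz₂, hz₂n, -, hz₂e⟩ := hcyc n ⟨m₂, hm₂.1⟩
      (fun h => hm₂.2 (congrArg Subtype.val h).symm) Q₂ hQ₂p hQ₂c (fun b hb => (hQ₂H b hb).1)
      (fun b hb hbN => by
        by_cases h : b = n.1
        · exact Or.inl h
        · exact Or.inr (hQ₂N b hb ⟨hbN, h⟩))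
    refine ⟨⟨z₁, hz₁⟩, ⟨z₂, hz₂⟩, fun h => ?_, hz₁n, hz₂n⟩
    have h12 : z₁ = z₂ := congrArg Subtype.val h
    have h1 := hz₁Q ⟨s(n.1, a), hna⟩ haQ
    rw [h12] at h1
    rcases hz₂e _ h1 a (by simp) with h2 | h2
    · exact (hQ₂H a h2).2 rfl
    · exact hD.notMem a h2 haH
  have : Nonempty N := ⟨⟨u, huN⟩⟩
  have hdep := not_linearIndependent_of_two_entries (fun (z : X) (n : N) => z.1 (edge n))
    (fun z => z.2.2.2) htwo
  rw [Fintype.not_linearIndependent_iff] at hdep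
  -- A nontrivial combination of the cycles in `X` vanishes on all attaching edges.
  obtain ⟨g, hg, i, hgi⟩ := hdep
  set z : G.edgeSet → ZMod 2 := ∑ j, g j • j.1 with hzdef
  have hXind : LinearIndepOn (ZMod 2) id (X ∪ chordlessVectorsIn H) :=
    hind.mono (Set.union_subset (fun _ h => h.1) (fun _ h => h.1))
  have hdisj : Disjoint X (chordlessVectorsIn H) := by
    rw [Set.disjoint_left]
    intro t ht ht'
    obtain ⟨n, hn⟩ : (Finset.univ.filter fun n => t (edge n) ≠ 0).Nonempty := by
      rw [← Finset.card_pos, ht.2.2]; norm_num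
    rw [Finset.mem_filter] at hn
    have := H.mem_verts_of_mem_edge (ht'.2 _ hn.2) (v := δ n) (by simp [edge])
    exact hD.notMem _ (hδD n) this
  obtain ⟨hX, -, hspan⟩ := (linearIndepOn_union_iff hdisj).1 hXind
  simp only [id_eq, Set.image_id'] at hspan
  have hzX : z ∈ Submodule.span (ZMod 2) X :=
    Submodule.sum_mem _ fun j _ => Submodule.smul_mem _ _ (Submodule.subset_span j.2)
  have hzf : z ∈ O.flows (ZMod 2) := by
    refine Submodule.sum_mem _ fun j _ => Submodule.smul_mem _ _ ?_
    obtain ⟨a, w, hw, -, h⟩ := j.2.1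
    rw [h]
    exact O.edgeIndicator_mem_flows w hw.isTrail
  have hz0 : ∀ n : N, z (edge n) = 0 := by
    intro n
    have := congrFun hg n
    simpa [hzdef, Finset.sum_apply] using this
  have hzs : ∀ e : G.edgeSet, z e ≠ 0 → ∀ a ∈ (e : Sym2 V), a ∈ H.verts ∨ a ∈ D.support := by
    intro e he
    rw [hzdef, Finset.sum_apply] at he
    obtain ⟨j, -, hj⟩ := Finset.exists_ne_zero_of_sum_ne_zero he
    refine j.2.2.1 e fun h0 => hj ?_
    rw [Pi.smul_apply, h0, smul_zero]
  -- No flow enters the ear through the attaching edges, and the ear is a chordless path, so `z`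
  -- vanishes on it as well.
  have hzD : ∀ e : G.edgeSet, ∀ a ∈ D.support, a ∈ (e : Sym2 V) → z e = 0 := by
    intro e a ha hae
    refine eq_zero_of_mem_support hzf hD.isPath hD.isChordless (fun e' he' b hb c hc heq => ?_)
      ha hae
    have hcH : c ∈ H.verts := (hzs e' he' c (by rw [heq]; simp)).resolve_right hc
    have hadj : G.Adj c b := by
      have := e'.2
      rw [heq] at this
      exact this.symm
    let n : N := ⟨c, hcH, b, hb, hadj⟩
    have hbδ : b = δ n := hD.adj_unique hcH hb (hδD n) hadj (hδ n)
    refine he' ?_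
    rw [← hz0 n]
    congr 1
    refine Subtype.ext (heq.trans ?_)
    rw [hbδ, Sym2.eq_swap]
  have hzH : ∀ e : G.edgeSet, z e ≠ 0 → (e : Sym2 V) ∈ H.edgeSet := by
    intro e he
    have hm : ∀ a ∈ (e : Sym2 V), a ∈ H.verts := fun a ha =>
      (hzs e he a ha).resolve_right fun h => he (hzD e a h ha)
    have hadj : G.Adj (O.tail e) (O.head e) := by
      have := e.2
      rwa [← O.mk_eq e] at this
    rw [← O.mk_eq e, Subgraph.mem_edgeSet]
    exact hH.isInduced (hm _ (O.tail_mem e)) (hm _ (O.head_mem e)) hadj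
  -- Thus `z` is a flow on `H`, spanned by the chordless cycles of `H` and also by those of `X`.
  -- Independence forces `z = 0`, although its coefficients are not all zero.
  have hzero : z = 0 := Submodule.disjoint_def.1 hspan z hzX (hH.mem_span z hzf hzH)
  have hXi : LinearIndependent (ZMod 2) fun j : X => j.1 := hX
  exact hgi (Fintype.linearIndependent_iff.1 hXi g (hzdef ▸ hzero) i)

/-- A cycle generated subgraph extends along a shortest ear with adjacent ends. -/
lemma IsCycleGenerated.sup_ear {H : G.Subgraph} (hH : O.IsCycleGenerated H) {u v x y : V}
    {D : G.Walk x y} (hD : D.IsMinimalEar H.verts u v) (hxy : x ≠ y) (huv : G.Adj u v) :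
    ∃ C : G.Subgraph, C.IsCycleSubgraph ∧ Subgraph.IsCliqueSum 2 H C (H ⊔ C) ∧ x ∈ C.verts ∧
      O.IsCycleGenerated (H ⊔ C) := by
  classical
  have hDW := hD.notMem
  have hQs : ∀ a ∈ (Walk.cons huv.symm Walk.nil).support, a = u ∨ a = v := by
    intro a ha
    simpa [or_comm] using ha
  have hQp : (Walk.cons huv.symm Walk.nil).IsPath := by
    simpa using huv.ne.symm
  have hQc : (Walk.cons huv.symm Walk.nil).IsChordless := by
    rw [Walk.isChordless_iff_forall_mem_edges]
    intro a b ha hb hab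
    rcases hQs a ha with rfl | rfl <;> rcases hQs b hb with rfl | rfl
    · exact absurd hab (G.loopless.irrefl _)
    · simp
    · simp
    · exact absurd hab (G.loopless.irrefl _)
  have hQW : ∀ a ∈ (Walk.cons huv.symm Walk.nil).support, a ∈ H.verts := by
    intro a ha
    rcases hQs a ha with rfl | rfl
    · exact hD.left_mem
    · exact hD.right_mem
  have hw := Walk.isCycle_cons_append_cons hD.left_adj hD.right_adj.symm hD.isPath hQp
    (fun a ha ha' => hDW a ha (hQW a ha')) huv.ne
  have hc := Walk.isChordless_cons_append_cons (W := H.verts) hD.left_adj hD.right_adj.symm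
    hD.isChordless hQc hDW hQW (fun a ha b hb b' hb' => hD.adj_unique ha hb hb')
    (fun a ha _ _ _ => hQs a ha)
  set w := Walk.cons hD.left_adj (D.append (.cons hD.right_adj.symm (.cons huv.symm .nil)))
    with hwdef
  have hedges : ∀ e, e ∈ w.edges ↔ e = s(u, x) ∨ e ∈ D.edges ∨ e = s(y, v) ∨ e = s(v, u) := by
    intro e
    simp [hwdef]
  have hsupp : ∀ a, a ∈ w.support ↔ a = u ∨ a = v ∨ a ∈ D.support := by
    intro a
    simp only [hwdef, Walk.support_cons, Walk.mem_support_append_iff, List.mem_cons,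
      Walk.support_nil, List.not_mem_nil, or_false]
    constructor
    · rintro (h | h | rfl | h | h)
      · exact Or.inl h
      · exact Or.inr (Or.inr h)
      · exact Or.inr (Or.inr D.end_mem_support)
      · exact Or.inr (Or.inl h)
      · exact Or.inl h
    · rintro (h | h | h)
      · exact Or.inl h
      · exact Or.inr (Or.inr (Or.inr (Or.inl h)))
      · exact Or.inr (Or.inl h)
  have hHuv : H.Adj u v := hH.isInduced hD.left_mem hD.right_mem huv
  have hCuv : w.toSubgraph.Adj u v := by
    rw [Walk.adj_toSubgraph_iff_mem_edges, hedges]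
    exact Or.inr (Or.inr (Or.inr Sym2.eq_swap))
  have hvert : ∀ a, a ∈ H.verts ∨ a ∈ w.support → a ∈ H.verts ∨ a ∈ D.support := by
    rintro a (h | h)
    · exact Or.inl h
    · rcases (hsupp a).1 h with rfl | rfl | h
      · exact Or.inl hD.left_mem
      · exact Or.inl hD.right_mem
      · exact Or.inr h
  -- Because `x ≠ y`, only the edges from `u` to `x` and from `v` to `y` join `H` to the ear. Hence
  -- the enlarged subgraph is again induced.
  have hmix : ∀ a ∈ H.verts, ∀ b ∈ D.support, G.Adj a b → s(a, b) ∈ w.edges := by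
    intro a ha b hb hab
    rw [hedges]
    rcases (hD.adj_cases ha hb hab).resolve_left hxy with ⟨rfl, rfl⟩ | ⟨rfl, rfl⟩
    · exact Or.inl rfl
    · exact Or.inr (Or.inr (Or.inl Sym2.eq_swap))
  refine ⟨w.toSubgraph, ⟨u, w, hw, rfl⟩, ?_, ?_, ?_, ?_, ?_⟩
  · refine Subgraph.isCliqueSum_two hHuv hCuv fun a ha ha' => ?_
    rw [Walk.mem_verts_toSubgraph, hsupp] at ha'
    rcases ha' with h | h | h
    · exact Or.inl h
    · exact Or.inr h
    · exact absurd ha (hDW a h)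
  · rw [Walk.mem_verts_toSubgraph, hsupp]
    exact Or.inr (Or.inr D.start_mem_support)
  · intro a ha b hb hab
    rw [Subgraph.verts_sup, Set.mem_union, Walk.mem_verts_toSubgraph] at ha hb
    rw [Subgraph.sup_adj, Walk.adj_toSubgraph_iff_mem_edges]
    rcases hvert a ha with ha | ha <;> rcases hvert b hb with hb | hb
    · exact Or.inl (hH.isInduced ha hb hab)
    · exact Or.inr (hmix a ha b hb hab)
    · rw [Sym2.eq_swap]
      exact Or.inr (hmix b hb a ha hab.symm)
    · exact Or.inr ((hedges _).2 (Or.inr (Or.inl (hD.isChordless.mem_edges ha hb hab))))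
  · refine hH.isNonseparable.sup (Subgraph.isNonseparable_toSubgraph_of_isCycle hw) huv.ne
      hD.left_mem ?_ hD.right_mem ?_
    · exact w.toSubgraph.edge_vert hCuv
    · exact w.toSubgraph.edge_vert hCuv.symm
  · intro z hz hs
    have hwin : w.edgeIndicator ∈ chordlessVectorsIn (H ⊔ w.toSubgraph) := by
      refine ⟨⟨u, w, hw, hc, rfl⟩, fun e he => ?_⟩
      rw [Subgraph.edgeSet_sup]
      exact Or.inr (w.mem_edges_toSubgraph.2 (Walk.edgeIndicator_ne_zero.1 he))
    have hmono : chordlessVectorsIn H ⊆ chordlessVectorsIn (H ⊔ w.toSubgraph) := fun t ht =>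
      ⟨ht.1, fun e he => Subgraph.edgeSet_mono le_sup_left (ht.2 e he)⟩
    set e₀ : G.edgeSet := ⟨s(u, x), hD.left_adj⟩ with he₀
    -- Subtracting a multiple of the new cycle kills the first edge of the ear. The flow then
    -- vanishes along the rest of the ear and lives on `H`.
    set z' := z - z e₀ • w.edgeIndicator with hz'
    have hz'f : z' ∈ O.flows (ZMod 2) :=
      Submodule.sub_mem _ hz (Submodule.smul_mem _ _ (O.edgeIndicator_mem_flows w hw.isTrail))
    have hz'0 : z' e₀ = 0 := by
      have : w.edgeIndicator e₀ = 1 := by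
        rw [Walk.edgeIndicator, if_pos]
        exact (hedges _).2 (Or.inl rfl)
      simp [hz', this]
    have hz's : ∀ e : G.edgeSet, z' e ≠ 0 → (e : Sym2 V) ∈ H.edgeSet ∨ (e : Sym2 V) ∈ w.edges := by
      intro e he
      by_cases h : (e : Sym2 V) ∈ w.edges
      · exact Or.inr h
      · have h0 : w.edgeIndicator e = 0 := by
          by_contra h1
          exact h (Walk.edgeIndicator_ne_zero.1 h1)
        have h1 : z e ≠ 0 := by simpa [hz', h0] using he
        have h2 := hs e h1
        rw [Subgraph.edgeSet_sup] at h2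
        exact h2.imp_right fun h => w.mem_edges_toSubgraph.1 h
    have hvD : v ∉ D.support := fun h => hDW v h hD.right_mem
    have huD : u ∉ D.support := fun h => hDW u h hD.left_mem
    have hzero := O.eq_zero_of_isPath (z := z') (D.concat hD.right_adj.symm)
      (hD.isPath.concat hvD _) (fun a _ _ => O.mem_flows.1 hz'f a) (fun e he => by
        rcases hz's e he with h | h
        · refine Or.inr fun a ha hav hae => ?_
          rw [Walk.support_concat, List.mem_append] at ha
          refine hDW a (ha.resolve_right (by simpa using hav)) ?_
          exact H.mem_verts_of_mem_edge h hae
        · rw [Walk.edges_concat, List.concat_eq_append, List.mem_append]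
          rcases (hedges _).1 h with h | h | h | h
          · exact absurd ((show e = e₀ from Subtype.ext h) ▸ hz'0) he
          · exact Or.inl (Or.inl h)
          · exact Or.inl (Or.inr (by simp [h]))
          · refine Or.inr fun a ha hav hae => ?_
            rw [Walk.support_concat, List.mem_append] at ha
            have haD : a ∈ D.support := ha.resolve_right (by simpa using hav)
            rw [h, Sym2.mem_iff] at hae
            rcases hae with rfl | rfl
            · exact hvD haD
            · exact huD haD)
    have hz'H : ∀ e : G.edgeSet, z' e ≠ 0 → (e : Sym2 V) ∈ H.edgeSet := by
      intro e he
      rcases hz's e he with h | h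
      · exact h
      · rcases (hedges _).1 h with h | h | h | h
        · exact absurd ((show e = e₀ from Subtype.ext h) ▸ hz'0) he
        · exact absurd (hzero e (by simp [h])) he
        · exact absurd (hzero e (by simp [h])) he
        · rw [h]
          exact hHuv.symm
    have := Submodule.add_mem _ (Submodule.span_mono hmono (hH.mem_span z' hz'f hz'H))
      (Submodule.smul_mem _ (z e₀) (Submodule.subset_span hwin))
    rwa [hz', sub_add_cancel] at this

end GraphOrientation

/-! ### Blocks of a bipartite graph with independent chordless cycles -/

namespace SimpleGraph.Subgraph

variable {V : Type*} {G : SimpleGraph V}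

/-- A block that is neither a vertex nor a bridge contains an edge that is not a bridge. -/
lemma IsGraphBlock.exists_adj_not_isBridge {B : G.Subgraph} (hB : B.IsGraphBlock)
    (h1 : ¬ B.IsVertex) (h2 : ¬ B.IsBridgeEdge) : ∃ a b, B.Adj a b ∧ ¬ G.IsBridge s(a, b) := by
  have hns := isNonseparable_iff.1 hB.1
  obtain ⟨a, ha⟩ := hns.1
  obtain ⟨b, hb, hba⟩ : ∃ b ∈ B.verts, b ≠ a := by
    by_contra hcon
    push Not at hcon
    refine h1 ⟨a, ?_⟩
    ext x y
    · rw [singletonSubgraph_verts, Set.mem_singleton_iff]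
      exact ⟨hcon x, fun h => h ▸ ha⟩
    · rw [singletonSubgraph_adj]
      refine ⟨fun h => ?_, fun h => h.elim⟩
      exact h.ne ((hcon x (B.edge_vert h)).trans (hcon y (B.edge_vert h.symm)).symm)
  obtain ⟨p, hp⟩ := hns.2.1 a ha b hb
  obtain ⟨c, hac⟩ : ∃ c, B.Adj a c := by
    cases p with
    | nil => exact absurd rfl hba
    | @cons _ c _ h q =>
      refine ⟨c, hp.2 ?_⟩
      rw [Walk.adj_toSubgraph_iff_mem_edges]
      simp
  refine ⟨a, c, hac, fun hbr => h2 ⟨a, c, hac.adj_sub, hbr, ?_⟩⟩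
  have hc := B.edge_vert hac.symm
  -- A third vertex would be reached from `a` without `c` and from `c` without `a`, which yields a
  -- walk from `a` to `c` around the bridge.
  have hverts : ∀ w ∈ B.verts, w = a ∨ w = c := by
    intro w hw
    by_contra hcon
    push Not at hcon
    obtain ⟨q, -, hq⟩ := hns.2.2 c hc a ha w hw hac.ne hcon.2
    obtain ⟨r, -, hr⟩ := hns.2.2 a ha w hw c hc hcon.1 hac.ne.symm
    have := isBridge_iff_forall_walk_mem_edges.1 hbr (q.append r)
    rw [Walk.edges_append, List.mem_append] at this
    rcases this with h | h
    · exact hq (q.snd_mem_support_of_mem_edges h)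
    · exact hr (r.fst_mem_support_of_mem_edges h)
  ext x y
  · rw [subgraphOfAdj_verts, Set.mem_insert_iff, Set.mem_singleton_iff]
    exact ⟨hverts x, by rintro (rfl | rfl) <;> assumption⟩
  · rw [subgraphOfAdj_adj]
    constructor
    · intro h
      rcases hverts x (B.edge_vert h) with rfl | rfl <;>
        rcases hverts y (B.edge_vert h.symm) with rfl | rfl
      · exact absurd rfl h.ne
      · rfl
      · exact Sym2.eq_swap
      · exact absurd rfl h.ne
    · intro h
      rw [← Subgraph.mem_edgeSet, ← h]
      exact hac

end SimpleGraph.Subgraph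

namespace SimpleGraph

variable {V : Type*} {G : SimpleGraph V}

/-- An edge that is not a bridge lies on a chordless cycle. -/
lemma exists_chordless_isCycle {a b : V} (hab : G.Adj a b) (h : ¬ G.IsBridge s(a, b)) :
    ∃ (u : V) (w : G.Walk u u), w.IsCycle ∧ w.IsChordless ∧ s(a, b) ∈ w.edges := by
  rw [isBridge_iff, not_not] at h
  obtain ⟨p₀⟩ := h
  -- A shortest path between the ends after deletion of the edge is chordless there, so its only
  -- chord in `G` is the deleted edge, which closes the cycle.
  obtain ⟨y, rfl, p, hp, hpc, -, -⟩ := Walk.exists_chordless_isPath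
    (s := Set.univ) (T := {b}) ⟨b, rfl, p₀, by simp⟩
  have hle := G.deleteEdges_le {s(a, y)}
  have hedge : ∀ e ∈ p.edges, e ≠ s(a, y) := by
    intro e he
    have := p.edges_subset_edgeSet he
    rw [edgeSet_deleteEdges] at this
    exact this.2
  refine ⟨y, .cons hab.symm (p.mapLe hle), ?_, ?_, ?_⟩
  · rw [Walk.cons_isCycle_iff, Walk.edges_mapLe_eq_edges]
    refine ⟨(Walk.isPath_mapLe hle).2 hp, fun h => hedge _ h Sym2.eq_swap⟩
  · rw [Walk.isChordless_iff_forall_mem_edges]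
    have hs : ∀ v ∈ (Walk.cons hab.symm (p.mapLe hle)).support, v ∈ p.support := by
      intro v hv
      rw [Walk.support_cons, Walk.support_mapLe_eq_support, List.mem_cons] at hv
      rcases hv with rfl | hv
      · exact p.end_mem_support
      · exact hv
    intro c d hc hd hcd
    rw [Walk.edges_cons, Walk.edges_mapLe_eq_edges, List.mem_cons]
    by_cases hcdab : s(c, d) = s(a, y)
    · exact Or.inl (hcdab.trans Sym2.eq_swap)
    · refine Or.inr (hpc.mem_edges (hs c hc) (hs d hd) ?_)
      rw [deleteEdges_adj]
      exact ⟨hcd, hcdab⟩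
  · rw [Walk.edges_cons, List.mem_cons]
    exact Or.inl Sym2.eq_swap

end SimpleGraph

namespace GraphOrientation

open SimpleGraph

variable {V : Type*} {G : SimpleGraph V}

/-- A bipartite graph with independent chordless cycles is a ring graph. -/
lemma isRingGraph_of_linearIndepOn [Finite V] [Fintype G.edgeSet] (O : GraphOrientation G)
    (hbip : G.IsBipartite) (hind : LinearIndepOn (ZMod 2) id G.chordlessVectors) :
    G.IsRingGraph := by
  classical
  intro B hB h1 h2
  obtain ⟨a, b, hBab, hnb⟩ := hB.exists_adj_not_isBridge h1 h2
  obtain ⟨u₀, w₀, hw₀, hc₀, hab₀⟩ := exists_chordless_isCycle hBab.adj_sub hnb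
  -- Grow from a chordless cycle through the edge `ab`. Keeping this edge keeps `H` inside the
  -- block.
  obtain ⟨H, -, hmax⟩ := Finite.exists_le_maximal
    (p := fun H : G.Subgraph => H.Adj a b ∧ H.IsTwoSumOfCycles ∧ O.IsCycleGenerated H)
    (a := w₀.toSubgraph) ⟨Walk.adj_toSubgraph_iff_mem_edges.2 hab₀, .cycle _ ⟨u₀, w₀, hw₀, rfl⟩,
      isCycleGenerated_toSubgraph hw₀ hc₀⟩
  obtain ⟨hHab, htwo, hH⟩ := hmax.prop
  have haH := H.edge_vert hHab
  have hbH := H.edge_vert hHab.symm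
  have hHB : H ≤ B := hB.sup_le hH.isNonseparable hHab.ne (B.edge_vert hBab) haH
    (B.edge_vert hBab.symm) hbH
  by_cases hverts : H.verts = B.verts
  · have hBH : B ≤ H := ⟨hverts.ge, fun x y hxy => hH.isInduced
      (hverts.ge (B.edge_vert hxy)) (hverts.ge (B.edge_vert hxy.symm)) hxy.adj_sub⟩
    rwa [le_antisymm hBH hHB]
  exfalso
  obtain ⟨_, _, _, _, _, hear⟩ := hB.1.exists_isEar hHB.1 hverts hHab.ne haH hbH
  obtain ⟨u, v, x, y, D, hD⟩ := hear.exists_isMinimalEar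
  obtain ⟨n, hn, m, hm, d, hd, d', hd', hnd, hmd', hnm⟩ := exists_adj_of_isMinimalEar hind hH hD
  -- On a one-vertex ear the adjacent attaching vertices would form a triangle with it, which is
  -- impossible in a bipartite graph.
  have hxy : x ≠ y := by
    intro hxy
    obtain rfl := hD.support_of_eq hxy hd
    obtain rfl := hD.support_of_eq hxy hd'
    obtain ⟨c⟩ := hbip
    have e1 : c n ≠ c d' := c.valid hnd
    have e2 : c m ≠ c d' := c.valid hmd'
    have e3 : c n ≠ c m := c.valid hnm
    omega
  have huv : G.Adj u v := by
    rcases (hD.adj_cases hn hd hnd).resolve_left hxy with ⟨rfl, -⟩ | ⟨rfl, -⟩ <;>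
      rcases (hD.adj_cases hm hd' hmd').resolve_left hxy with ⟨rfl, -⟩ | ⟨rfl, -⟩
    · exact absurd rfl hnm.ne
    · exact hnm
    · exact hnm.symm
    · exact absurd rfl hnm.ne
  obtain ⟨C, hC, hsum, hxC, hgen⟩ := hH.sup_ear hD hxy huv
  have hle : H ⊔ C ≤ H := hmax.le_of_ge
    ⟨Or.inl hHab, .sum H C (H ⊔ C) htwo hC hsum, hgen⟩ le_sup_left
  exact hD.notMem x D.start_mem_support (hle.1 (Or.inr hxC))

theorem isRingGraph_of_isCIOGraph [Finite V] (k : Type*) [Field k] (hbip : G.IsBipartite)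
    (hG : G.IsCIOGraph k) : G.IsRingGraph := by
  classical
  have := Fintype.ofFinite G.edgeSet
  obtain ⟨O, ε, hε, hO⟩ := exists_orientation_of_isBipartite hbip
  exact isRingGraph_of_linearIndepOn O hbip (linearIndepOn_chordlessVectors hε hO (hG O))

end GraphOrientation

theorem mainTheorem12 {V : Type*} [Finite V] (G : SimpleGraph V) (k : Type*) [Field k] :
    (G.IsRingGraph → G.IsCIOGraph k) ∧ (G.IsBipartite → G.IsCIOGraph k → G.IsRingGraph) :=
  ⟨GraphOrientation.isCIOGraph_of_isRingGraph k, GraphOrientation.isRingGraph_of_isCIOGraph k⟩
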